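/- **Theorem.** Let $M$ be a Kähler–Poisson manifold, that is, a complex manifold with a (smooth, real) Poisson structure $\pi$ such that the Poisson bracket, extended complex-bilinearly, of any two local holomorphic functions vanishes. Let $\mathcal F\subset T_{\mathbb C}M$ be the antiholomorphic tangent bundle. Let $\Sigma$ be a symplectic groupoid integrating $M$: a Lie groupoid over $M$, with source $\mathsf s$, target $\mathsf t$, multiplication $\mathsf m:\Sigma_2\to\Sigma$ on the manifold $\Sigma_2=\{(\gamma,\eta)\mid \mathsf s(\gamma)=\mathsf t(\eta)\}$ of composable pairs, and inverse $\mathrm{inv}$, together with a symplectic form $\omega$ on $\Sigma$ such that $\mathsf m^*\omega=\mathrm{pr}_1^*\omega+\mathrm{pr}_2^*\omega$ on $\Sigma_2$, such that $\mathsf t:\Sigma\to M$ is a Poisson map and the fibers of $\mathsf s$ are connected. Suppose that $$\mathcal P:=T(\mathsf t,\mathsf s)^{-1}(\mathcal F\times\bar{\mathcal F})=\{X\in T_{\mathbb C}\Sigma\mid T\mathsf t(X)\in\mathcal F,\ T\mathsf s(X)\in\bar{\mathcal F}\}$$ is a regular distribution, i.e. a smooth complex subbundle of $T_{\mathbb C}\Sigma$.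 Then $\mathcal P$ is a polarization of $\Sigma$ as a symplectic groupoid; that is, $\mathcal P$ is 1. involutive: the Lie bracket of any two smooth local sections of $\mathcal P$ is a section of $\mathcal P$; 2. multiplicative: with $\mathcal P_2:=(\mathcal P\times\mathcal P)\cap T_{\mathbb C}\Sigma_2$, one has $T\mathsf m(\mathcal P_{2\,(\gamma,\eta)})=\mathcal P_{\gamma\eta}$ for every $(\gamma,\eta)\in\Sigma_2$; 3. Hermitian: $T\mathrm{inv}(\mathcal P)=\bar{\mathcal P}$; 4. Lagrangian: $\mathcal P$ equals its own orthogonal with respect to the complex-bilinear extension of $\omega$. -/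

import Mathlib

open scoped Manifold ContDiff TensorProduct
open VectorField

noncomputable section

/-! ### Complexified tangent spaces -/

section Complexification

variable {V : Type*} [AddCommGroup V] [Module ℝ V]

/-- The complex vector `X + iY` of the complexification `ℂ ⊗ V` of a real vector space `V`.
Every element of `ℂ ⊗ V` is uniquely of this form. -/
def complexVector (X Y : V) : ℂ ⊗[ℝ] V :=
  (1 : ℂ) ⊗ₜ[ℝ] X + Complex.I ⊗ₜ[ℝ] Y

variable (V) in
/-- Complex conjugation `z ⊗ v ↦ z̄ ⊗ v` on `ℂ ⊗ V`, a conjugate-linear map. -/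
def complexConj : (ℂ ⊗[ℝ] V) →ₛₗ[starRingEnd ℂ] (ℂ ⊗[ℝ] V) where
  toFun := LinearMap.rTensor V Complex.conjAe.toLinearMap
  map_add' x y := map_add _ x y
  map_smul' c x := by
    induction x using TensorProduct.induction_on with
    | zero => simp
    | tmul z v => simp [TensorProduct.smul_tmul', LinearMap.rTensor_tmul]
    | add x y hx hy => rw [smul_add, map_add, hx, hy, map_add, smul_add]

/-- The complex conjugate `P̄ = {v | v̄ ∈ P}` of a complex subspace `P` of `ℂ ⊗ V`. -/
def conjSubmodule (P : Submodule ℂ (ℂ ⊗[ℝ] V)) : Submodule ℂ (ℂ ⊗[ℝ] V) :=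
  P.comap (complexConj V)

end Complexification

section Manifolds

variable {E : Type*} [NormedAddCommGroup E] [NormedSpace ℝ E]
  {M : Type*} [TopologicalSpace M] [ChartedSpace E M]
  {E' : Type*} [NormedAddCommGroup E'] [NormedSpace ℝ E']
  {M' : Type*} [TopologicalSpace M'] [ChartedSpace E' M']

variable (E) in
/-- The complexified tangent space `T_{ℂ,x} M`. -/
abbrev ComplexTangentSpace (x : M) : Type _ :=
  ℂ ⊗[ℝ] TangentSpace 𝓘(ℝ, E) x

variable (E E') in
/-- The complexified tangent map `T_{ℂ,x} M → T_{ℂ,f(x)} M'` of a map `f : M → M'`. -/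
def complexTangentMap (f : M → M') (x : M) :
    ComplexTangentSpace E x →ₗ[ℂ] ComplexTangentSpace E' (f x) :=
  LinearMap.baseChange ℂ (mfderiv 𝓘(ℝ, E) 𝓘(ℝ, E') f x).toLinearMap

/-- `X` is a smooth (real) vector field on `U`. -/
def IsSmoothField [IsManifold 𝓘(ℝ, E) ∞ M] (U : Set M)
    (X : ∀ x : M, TangentSpace 𝓘(ℝ, E) x) : Prop :=
  ContMDiffOn 𝓘(ℝ, E) 𝓘(ℝ, E).tangent ∞
    (fun x => (⟨x, X x⟩ : TangentBundle 𝓘(ℝ, E) M)) U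

/-! ### Complex distributions -/

variable (E M) in
/-- A (possibly singular) complex distribution: a complex subspace of each complexified tangent
space. -/
abbrev ComplexDistribution : Type _ := ∀ x : M, Submodule ℂ (ComplexTangentSpace E x)

/-- `P` is a regular distribution, i.e. a smooth complex subbundle of `T_ℂ M`: near every point
it is spanned by finitely many smooth complex vector fields `X i + i Y i` that are linearly
independent at each point. -/
def IsRegularDistribution [IsManifold 𝓘(ℝ, E) ∞ M] (P : ComplexDistribution E M) : Prop :=
  ∀ x₀ : M, ∃ U : Set M, IsOpen U ∧ x₀ ∈ U ∧
    ∃ (r : ℕ) (X Y : Fin r → ∀ x : M, TangentSpace 𝓘(ℝ, E) x),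
      (∀ i, IsSmoothField U (X i)) ∧ (∀ i, IsSmoothField U (Y i)) ∧
      ∀ x ∈ U, LinearIndependent ℂ (fun i => complexVector (X i x) (Y i x)) ∧
        Submodule.span ℂ (Set.range fun i => complexVector (X i x) (Y i x)) = P x

/-- `P` is involutive: the Lie bracket of two smooth complex vector fields `X₁ + iX₂`, `Y₁ + iY₂`
with values in `P`, defined on a common open set, has values in `P`. The bracket is extended
complex-bilinearly. -/
def IsInvolutive [IsManifold 𝓘(ℝ, E) ∞ M] (P : ComplexDistribution E M) : Prop :=
  ∀ U : Set M, IsOpen U → ∀ X₁ X₂ Y₁ Y₂ : ∀ x : M, TangentSpace 𝓘(ℝ, E) x,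
    IsSmoothField U X₁ → IsSmoothField U X₂ → IsSmoothField U Y₁ → IsSmoothField U Y₂ →
    (∀ x ∈ U, complexVector (X₁ x) (X₂ x) ∈ P x) →
    (∀ x ∈ U, complexVector (Y₁ x) (Y₂ x) ∈ P x) →
    ∀ x ∈ U, complexVector
      (mlieBracket 𝓘(ℝ, E) X₁ Y₁ x - mlieBracket 𝓘(ℝ, E) X₂ Y₂ x)
      (mlieBracket 𝓘(ℝ, E) X₁ Y₂ x + mlieBracket 𝓘(ℝ, E) X₂ Y₁ x) ∈ P x

/-! ### Poisson structures -/

variable (E M) in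
/-- A Poisson structure, given by its bivector field `π`, regarded as an alternating bilinear form
on each cotangent space: `{f, g} = π(df, dg)` takes smooth functions to smooth functions and
satisfies the Jacobi identity. -/
structure PoissonStructure where
  bivector : ∀ x : M,
    (TangentSpace 𝓘(ℝ, E) x →L[ℝ] ℝ) →ₗ[ℝ] (TangentSpace 𝓘(ℝ, E) x →L[ℝ] ℝ) →ₗ[ℝ] ℝ
  alternating : ∀ (x : M) (α : TangentSpace 𝓘(ℝ, E) x →L[ℝ] ℝ), bivector x α α = 0
  smooth : ∀ U : Set M, IsOpen U → ∀ f g : M → ℝ,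
    ContMDiffOn 𝓘(ℝ, E) 𝓘(ℝ, ℝ) ∞ f U → ContMDiffOn 𝓘(ℝ, E) 𝓘(ℝ, ℝ) ∞ g U →
    ContMDiffOn 𝓘(ℝ, E) 𝓘(ℝ, ℝ) ∞
      (fun x => bivector x (mvfderiv 𝓘(ℝ, E) f x) (mvfderiv 𝓘(ℝ, E) g x)) U
  jacobi : ∀ U : Set M, IsOpen U → ∀ f g h : M → ℝ,
    ContMDiffOn 𝓘(ℝ, E) 𝓘(ℝ, ℝ) ∞ f U → ContMDiffOn 𝓘(ℝ, E) 𝓘(ℝ, ℝ) ∞ g U →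
    ContMDiffOn 𝓘(ℝ, E) 𝓘(ℝ, ℝ) ∞ h U →
    let bracket : (M → ℝ) → (M → ℝ) → M → ℝ := fun f g x =>
      bivector x (mvfderiv 𝓘(ℝ, E) f x) (mvfderiv 𝓘(ℝ, E) g x)
    ∀ x ∈ U, bracket f (bracket g h) x + bracket g (bracket h f) x
      + bracket h (bracket f g) x = 0

/-- The Poisson bracket `{f, g} = π(df, dg)`. -/
def PoissonStructure.bracket (π : PoissonStructure E M) (f g : M → ℝ) (x : M) : ℝ :=
  π.bivector x (mvfderiv 𝓘(ℝ, E) f x) (mvfderiv 𝓘(ℝ, E) g x)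

/-- The complex-bilinear extension of the Poisson bracket to complex-valued functions. -/
def PoissonStructure.complexBracket (π : PoissonStructure E M) (f g : M → ℂ) (x : M) : ℂ :=
  ((π.bracket (fun y => (f y).re) (fun y => (g y).re) x
      - π.bracket (fun y => (f y).im) (fun y => (g y).im) x : ℝ) : ℂ)
    + Complex.I *
      ((π.bracket (fun y => (f y).re) (fun y => (g y).im) x
        + π.bracket (fun y => (f y).im) (fun y => (g y).re) x : ℝ) : ℂ)

/-! ### Symplectic forms -/

variable (E M) in
/-- A symplectic form: a smooth, closed, nondegenerate 2-form `ω`. Closedness is expressed by the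
invariant formula for `dω(X, Y, Z)`. -/
structure SymplecticForm [IsManifold 𝓘(ℝ, E) ∞ M] where
  form : ∀ x : M, LinearMap.BilinForm ℝ (TangentSpace 𝓘(ℝ, E) x)
  alternating : ∀ (x : M) (X : TangentSpace 𝓘(ℝ, E) x), form x X X = 0
  nondegenerate : ∀ (x : M) (X : TangentSpace 𝓘(ℝ, E) x), (∀ Y, form x X Y = 0) → X = 0
  smooth : ∀ U : Set M, IsOpen U → ∀ X Y : ∀ x : M, TangentSpace 𝓘(ℝ, E) x,
    IsSmoothField U X → IsSmoothField U Y →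
    ContMDiffOn 𝓘(ℝ, E) 𝓘(ℝ, ℝ) ∞ (fun x => form x (X x) (Y x)) U
  closed : ∀ U : Set M, IsOpen U → ∀ X Y Z : ∀ x : M, TangentSpace 𝓘(ℝ, E) x,
    IsSmoothField U X → IsSmoothField U Y → IsSmoothField U Z → ∀ x ∈ U,
    mvfderiv 𝓘(ℝ, E) (fun y => form y (Y y) (Z y)) x (X x)
      - mvfderiv 𝓘(ℝ, E) (fun y => form y (X y) (Z y)) x (Y x)
      + mvfderiv 𝓘(ℝ, E) (fun y => form y (X y) (Y y)) x (Z x)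
      - form x (mlieBracket 𝓘(ℝ, E) X Y x) (Z x)
      + form x (mlieBracket 𝓘(ℝ, E) X Z x) (Y x)
      - form x (mlieBracket 𝓘(ℝ, E) Y Z x) (X x) = 0

/-- A complex distribution is Lagrangian if it equals its own orthogonal with respect to the
complex-bilinear extension of the symplectic form. -/
def IsLagrangian [IsManifold 𝓘(ℝ, E) ∞ M] (Ω : SymplecticForm E M)
    (P : ComplexDistribution E M) : Prop :=
  ∀ (x : M) (X : ComplexTangentSpace E x),
    X ∈ P x ↔ ∀ Y ∈ P x, LinearMap.BilinForm.baseChange ℂ (Ω.form x) X Y = 0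

/-- A map `f` from a symplectic manifold to a Poisson manifold is a Poisson map: the Poisson
bivectors are `f`-related. The Poisson bivector of `Ω` is `(ξ, ζ) ↦ Ω(X_ξ, X_ζ)`, where `X_ξ` is
the vector with `Ω(X_ξ, ·) = ξ`. -/
def IsPoissonMap [IsManifold 𝓘(ℝ, E) ∞ M] (Ω : SymplecticForm E M)
    (π : PoissonStructure E' M') (f : M → M') : Prop :=
  ∀ (x : M) (α β : TangentSpace 𝓘(ℝ, E') (f x) →L[ℝ] ℝ) (X Y : TangentSpace 𝓘(ℝ, E) x),
    (∀ Z, Ω.form x X Z = α (mfderiv 𝓘(ℝ, E) 𝓘(ℝ, E') f x Z)) →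
    (∀ Z, Ω.form x Y Z = β (mfderiv 𝓘(ℝ, E) 𝓘(ℝ, E') f x Z)) →
    Ω.form x X Y = π.bivector (f x) α β

end Manifolds

/-! ### Lie groupoids -/

section Groupoids

variable (EG : Type*) [NormedAddCommGroup EG] [NormedSpace ℝ EG]
  (G : Type*) [TopologicalSpace G] [ChartedSpace EG G]
  (E : Type*) [NormedAddCommGroup E] [NormedSpace ℝ E]
  (M : Type*) [TopologicalSpace M] [ChartedSpace E M]

/-- A Lie groupoid `G` over `M`. The product `mul γ η` is meaningful only if `src γ = tgt η`; its
other values are never used. The set of composable pairs is an embedded submanifold of `G × G`,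
because `src` and `tgt` are submersions, and smoothness on it is the existence of local smooth
extensions, which is what `ContMDiffOn` amounts to on an embedded submanifold. -/
structure LieGroupoid where
  src : G → M
  tgt : G → M
  unit : M → G
  inv : G → G
  mul : G → G → G
  src_unit : ∀ x, src (unit x) = x
  tgt_unit : ∀ x, tgt (unit x) = x
  src_mul : ∀ γ η, src γ = tgt η → src (mul γ η) = src η
  tgt_mul : ∀ γ η, src γ = tgt η → tgt (mul γ η) = tgt γ
  mul_assoc : ∀ γ η ζ, src γ = tgt η → src η = tgt ζ → mul (mul γ η) ζ = mul γ (mul η ζ)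
  unit_mul : ∀ γ, mul (unit (tgt γ)) γ = γ
  mul_unit : ∀ γ, mul γ (unit (src γ)) = γ
  src_inv : ∀ γ, src (inv γ) = tgt γ
  tgt_inv : ∀ γ, tgt (inv γ) = src γ
  inv_mul : ∀ γ, mul (inv γ) γ = unit (src γ)
  mul_inv : ∀ γ, mul γ (inv γ) = unit (tgt γ)
  smooth_src : ContMDiff 𝓘(ℝ, EG) 𝓘(ℝ, E) ∞ src
  smooth_tgt : ContMDiff 𝓘(ℝ, EG) 𝓘(ℝ, E) ∞ tgt
  submersion_src : ∀ γ, Function.Surjective (mfderiv 𝓘(ℝ, EG) 𝓘(ℝ, E) src γ)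
  submersion_tgt : ∀ γ, Function.Surjective (mfderiv 𝓘(ℝ, EG) 𝓘(ℝ, E) tgt γ)
  smooth_unit : ContMDiff 𝓘(ℝ, E) 𝓘(ℝ, EG) ∞ unit
  smooth_inv : ContMDiff 𝓘(ℝ, EG) 𝓘(ℝ, EG) ∞ inv
  smooth_mul : ContMDiffOn (𝓘(ℝ, EG).prod 𝓘(ℝ, EG)) 𝓘(ℝ, EG) ∞
    (fun p : G × G => mul p.1 p.2) {p : G × G | src p.1 = tgt p.2}

variable {EG G E M}

namespace LieGroupoid

/-- The set `G₂` of composable pairs. -/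
def composable (𝒢 : LieGroupoid EG G E M) : Set (G × G) :=
  {p | 𝒢.src p.1 = 𝒢.tgt p.2}

/-- The tangent map of the multiplication `G₂ → G` at a composable pair `(γ, η)`. It is only
applied to pairs `(X, Y)` of composable vectors, that is, `Ts(X) = Tt(Y)`. These are the vectors
tangent to `G₂`, and on them all derivatives within `G₂` agree (see `tangentMul_velocity`). -/
def tangentMul (𝒢 : LieGroupoid EG G E M) (γ η : G) :
    (TangentSpace 𝓘(ℝ, EG) γ × TangentSpace 𝓘(ℝ, EG) η) →L[ℝ]
      TangentSpace 𝓘(ℝ, EG) (𝒢.mul γ η) :=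
  mfderivWithin (𝓘(ℝ, EG).prod 𝓘(ℝ, EG)) 𝓘(ℝ, EG)
    (fun p : G × G => 𝒢.mul p.1 p.2) 𝒢.composable (γ, η)

/-- `tangentMul` takes the velocity of a curve of composable pairs to the velocity of the curve of
products. -/
theorem tangentMul_velocity (𝒢 : LieGroupoid EG G E M) (c : ℝ → G × G)
    (hc : MDifferentiableAt 𝓘(ℝ, ℝ) (𝓘(ℝ, EG).prod 𝓘(ℝ, EG)) c 0)
    (h : ∀ t, c t ∈ 𝒢.composable) :
    mfderiv 𝓘(ℝ, ℝ) 𝓘(ℝ, EG) (fun t => 𝒢.mul (c t).1 (c t).2) 0 (1 : ℝ) =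
      𝒢.tangentMul (c 0).1 (c 0).2
        (mfderiv 𝓘(ℝ, ℝ) (𝓘(ℝ, EG).prod 𝓘(ℝ, EG)) c 0 (1 : ℝ)) := by
  have h1 : MDifferentiableWithinAt (𝓘(ℝ, EG).prod 𝓘(ℝ, EG)) 𝓘(ℝ, EG)
      (fun p : G × G => 𝒢.mul p.1 p.2) 𝒢.composable (c 0) :=
    (𝒢.smooth_mul (c 0) (h 0)).mdifferentiableWithinAt (by simp)
  have h2 := h1.hasMFDerivWithinAt.comp (0 : ℝ) (hc.hasMFDerivAt.hasMFDerivWithinAt (s := Set.univ))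
    (fun t _ => h t)
  rw [hasMFDerivWithinAt_univ] at h2
  have h3 := h2.mfderiv
  exact congrArg (fun L => L (1 : ℝ)) h3

/-- The complexification of `tangentMul`. -/
def complexTangentMul (𝒢 : LieGroupoid EG G E M) (γ η : G)
    (X : ComplexTangentSpace EG γ) (Y : ComplexTangentSpace EG η) :
    ComplexTangentSpace EG (𝒢.mul γ η) :=
  LinearMap.baseChange ℂ ((𝒢.tangentMul γ η).toLinearMap ∘ₗ LinearMap.inl ℝ _ _) X +
    LinearMap.baseChange ℂ ((𝒢.tangentMul γ η).toLinearMap ∘ₗ LinearMap.inr ℝ _ _) Y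

/-- `X` and `Y` are composable in the complexified tangent groupoid: `T s (X) = T t (Y)` as
elements of the complexified tangent bundle of `M`. -/
def ComplexComposable (𝒢 : LieGroupoid EG G E M) {γ η : G}
    (X : ComplexTangentSpace EG γ) (Y : ComplexTangentSpace EG η) : Prop :=
  (⟨𝒢.src γ, complexTangentMap EG E 𝒢.src γ X⟩ : Σ x : M, ComplexTangentSpace E x) =
    ⟨𝒢.tgt η, complexTangentMap EG E 𝒢.tgt η Y⟩

/-- `P` is multiplicative: `T m (P₂) = P`, where `P₂ = (P × P) ∩ T_ℂ G₂`. -/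
def IsMultiplicative (𝒢 : LieGroupoid EG G E M) (P : ComplexDistribution EG G) : Prop :=
  ∀ γ η : G, 𝒢.src γ = 𝒢.tgt η →
    {Z | ∃ X ∈ P γ, ∃ Y ∈ P η, 𝒢.ComplexComposable X Y ∧ 𝒢.complexTangentMul γ η X Y = Z} =
      (P (𝒢.mul γ η) : Set (ComplexTangentSpace EG (𝒢.mul γ η)))

/-- `P` is Hermitian: `T inv (P) = P̄`. -/
def IsHermitian (𝒢 : LieGroupoid EG G E M) (P : ComplexDistribution EG G) : Prop :=
  ∀ γ : G, (P γ).map (complexTangentMap EG EG 𝒢.inv γ) = conjSubmodule (P (𝒢.inv γ))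

/-- The distribution `T(t, s)⁻¹(F × F')` on `G`, for distributions `F` and `F'` on `M`. -/
def anchorPreimage (𝒢 : LieGroupoid EG G E M) (F F' : ComplexDistribution E M) :
    ComplexDistribution EG G := fun γ =>
  (F (𝒢.tgt γ)).comap (complexTangentMap EG E 𝒢.tgt γ) ⊓
    (F' (𝒢.src γ)).comap (complexTangentMap EG E 𝒢.src γ)

end LieGroupoid

/-! ### Symplectic groupoids -/

variable (EG G E M) in
/-- A symplectic groupoid: a Lie groupoid with a symplectic form satisfying
`m^* ω = pr₁^* ω + pr₂^* ω` on the manifold of composable pairs. -/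
structure SymplecticGroupoid [IsManifold 𝓘(ℝ, EG) ∞ G] extends LieGroupoid EG G E M where
  form : SymplecticForm EG G
  multiplicative : ∀ γ η : G, src γ = tgt η →
    ∀ (X X' : TangentSpace 𝓘(ℝ, EG) γ) (Y Y' : TangentSpace 𝓘(ℝ, EG) η),
    tangentMap 𝓘(ℝ, EG) 𝓘(ℝ, E) src ⟨γ, X⟩ = tangentMap 𝓘(ℝ, EG) 𝓘(ℝ, E) tgt ⟨η, Y⟩ →
    tangentMap 𝓘(ℝ, EG) 𝓘(ℝ, E) src ⟨γ, X'⟩ = tangentMap 𝓘(ℝ, EG) 𝓘(ℝ, E) tgt ⟨η, Y'⟩ →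
    form.form (mul γ η) (toLieGroupoid.tangentMul γ η (X, Y))
        (toLieGroupoid.tangentMul γ η (X', Y')) =
      form.form γ X X' + form.form η Y Y'

/-- A symplectic groupoid integrates the Poisson manifold `(M, π)` if its target map is a Poisson
map and the fibers of its source map are connected. -/
structure SymplecticGroupoid.Integrates [IsManifold 𝓘(ℝ, EG) ∞ G]
    (S : SymplecticGroupoid EG G E M) (π : PoissonStructure E M) : Prop where
  isPoissonMap_tgt : IsPoissonMap S.form π S.tgt
  src_connected : ∀ x : M, IsConnected (S.src ⁻¹' {x})

/-- A polarization of a symplectic groupoid: a (regular) complex distribution that is involutive,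
multiplicative, Hermitian and Lagrangian. -/
structure SymplecticGroupoid.IsPolarization [IsManifold 𝓘(ℝ, EG) ∞ G]
    (S : SymplecticGroupoid EG G E M) (P : ComplexDistribution EG G) : Prop where
  regular : IsRegularDistribution P
  involutive : IsInvolutive P
  multiplicative : S.IsMultiplicative P
  hermitian : S.IsHermitian P
  lagrangian : IsLagrangian S.form P

end Groupoids

/-! ### Complex manifolds -/

section ComplexManifolds

variable {E : Type*} [NormedAddCommGroup E] [NormedSpace ℂ E]
  {M : Type*} [TopologicalSpace M] [ChartedSpace E M]

variable (E M) in
/-- The smooth real manifold underlying a complex manifold. -/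
instance isManifold_real_of_complex [IsManifold 𝓘(ℂ, E) ω M] : IsManifold 𝓘(ℝ, E) ∞ M := by
  apply isManifold_of_contDiffOn
  intro e e' he he'
  have h : ContDiffOn ℂ ω (𝓘(ℂ, E) ∘ e.symm ≫ₕ e' ∘ 𝓘(ℂ, E).symm)
      (𝓘(ℂ, E).symm ⁻¹' (e.symm ≫ₕ e').source ∩ Set.range 𝓘(ℂ, E)) :=
    (contDiffGroupoid ω 𝓘(ℂ, E)).compatible he he' |>.1
  exact (h.restrict_scalars ℝ).of_le le_top

/-- The complex structure `J` on the real tangent space at `x`: multiplication by `i`. The tangent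
space at `x` is the model space `E`, through the preferred chart at `x`; since the transition maps
are holomorphic, any other chart gives the same `J`. -/
def almostComplexStructure (x : M) :
    TangentSpace 𝓘(ℝ, E) x →ₗ[ℝ] TangentSpace 𝓘(ℝ, E) x :=
  show E →ₗ[ℝ] E from
    { toFun := fun v => Complex.I • v
      map_add' := fun v w => smul_add Complex.I v w
      map_smul' := fun r v => smul_comm Complex.I r v }

variable (E M) in
/-- The antiholomorphic tangent bundle: the eigenspaces of `J` for `-i` in the complexified tangent
spaces. -/
def antiholomorphicTangentBundle : ComplexDistribution E M := fun x =>
  Module.End.eigenspace (LinearMap.baseChange ℂ (almostComplexStructure (E := E) x)) (-Complex.I)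

/-- A Poisson structure on a complex manifold is Kähler–Poisson if the Poisson bracket of any two
local holomorphic functions vanishes. -/
def PoissonStructure.IsKaehlerPoisson (π : PoissonStructure E M) : Prop :=
  ∀ U : Set M, IsOpen U → ∀ f g : M → ℂ,
    MDifferentiableOn 𝓘(ℂ, E) 𝓘(ℂ, ℂ) f U → MDifferentiableOn 𝓘(ℂ, E) 𝓘(ℂ, ℂ) g U →
    ∀ x ∈ U, π.complexBracket f g x = 0

end ComplexManifolds

end

/-!
Write `t`, `s` for the target and the source, `F` for the antiholomorphic tangent bundle and
`P = T(t, s)⁻¹(F × F̄) = A ∩ B`, where `A = Tt⁻¹(F)` and `B = Ts⁻¹(F̄)`.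

*Orthogonals.* Multiplicativity of `ω` makes the unit section isotropic (`formAt_dUnit`), the
inversion antisymplectic (`formAt_dInv`), and the fibres of `s` and `t` symplectically orthogonal
(`formAt_ker_src_ker_tgt`). Hence `dim Σ = 2 dim M`, and the tangent spaces of the two kinds of
fibres are each other's orthogonals (`dSrc_eq_zero`, `dTgt_eq_zero`). A vector of `A^⊥` is
therefore tangent to an `s`-fibre, and it is the Hamiltonian vector of the pullback by `t` of a
covector `α` of type `(1,0)`. Since the Poisson bracket of holomorphic functions vanishes, `π`
vanishes on pairs of `(1,0)`-covectors (`PoissonStructure.IsKaehlerPoisson.bivector_eq`), and as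
`t` is a Poisson map, `A^⊥ ⊆ A` (`coisotropic_preimage_antiholomorphic`). The same holds for `B`,
by inversion. So `P^⊥ = A^⊥ + B^⊥` is contained in `(P ∩ ker Ts) + (P ∩ ker Tt)`
(`orthogonal_polarizationSubspace_le`).

*Lagrangian.* At a unit, `T_ℂ Σ` contains a copy of `T_ℂ M` complementary to `P`, so `P` has rank
`dim M` there (`finrank_polarizationSubspace_of_section`). The rank of a subbundle is locally
constant, and every point is joined to a unit inside its `s`-fibre, which is connected; so the
rank is half of `dim Σ` everywhere, and `P^⊥ ⊆ P` is an equality.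

*Multiplicative.* Since `P = P^⊥`, every vector of `P` is the sum of one in `P ∩ ker Ts` and one
in `P ∩ ker Tt`. Right and left translations carry these to the two factors of a composable pair
(`exists_dMul_zero_right`, `exists_dMul_zero_left`). Conversely, composable vectors of `P` meet in
`F ∩ F̄ = 0`, so `P₂` consists of pairs of such vectors (`isMultiplicative_polarizationAt`).

*Involutive and Hermitian.* In a holomorphic chart `φ`, membership in `A` is the equation
`d(φ ∘ t)(X₂) = i d(φ ∘ t)(X₁)` for `X = X₁ + i X₂`, which is preserved by brackets
(`mvfderiv_complex_mlieBracket`). The inversion interchanges `s` and `t`.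

The tangent spaces of Mathlib are all equal, by definition, to the model space. The tangent maps
of the structure maps are therefore regarded as maps of the model spaces, which avoids transport
along equalities of base points such as `t(γη) = t(γ)`.
-/

/-! ### Complexification of real vector spaces -/

section Complexification

variable {V V' : Type*} [AddCommGroup V] [Module ℝ V] [AddCommGroup V'] [Module ℝ V']

theorem exists_complexVector (z : ℂ ⊗[ℝ] V) : ∃ X Y : V, z = complexVector X Y := by
  induction z using TensorProduct.induction_on with
  | zero => exact ⟨0, 0, by simp [complexVector]⟩
  | tmul z v =>
    refine ⟨z.re • v, z.im • v, ?_⟩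
    rw [complexVector, TensorProduct.tmul_smul, TensorProduct.tmul_smul,
      TensorProduct.smul_tmul', TensorProduct.smul_tmul', ← TensorProduct.add_tmul]
    congr 1
    simp [Complex.re_add_im]
  | add x y hx hy =>
    obtain ⟨X, Y, rfl⟩ := hx
    obtain ⟨X', Y', rfl⟩ := hy
    refine ⟨X + X', Y + Y', ?_⟩
    simp only [complexVector, TensorProduct.tmul_add]
    abel

theorem complexVector_inj {X Y X' Y' : V} :
    complexVector X Y = complexVector X' Y' ↔ X = X' ∧ Y = Y' := by
  refine ⟨fun h => ⟨?_, ?_⟩, fun ⟨h, h'⟩ => by rw [h, h']⟩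
  · have := congrArg (TensorProduct.lid ℝ V ∘ LinearMap.rTensor V Complex.reLm) h
    simpa [complexVector] using this
  · have := congrArg (TensorProduct.lid ℝ V ∘ LinearMap.rTensor V Complex.imLm) h
    simpa [complexVector] using this

@[simp]
theorem complexVector_zero_zero : complexVector (0 : V) 0 = 0 := by
  simp [complexVector]

theorem complexVector_eq_zero {X Y : V} : complexVector X Y = 0 ↔ X = 0 ∧ Y = 0 := by
  rw [← complexVector_zero_zero, complexVector_inj]

theorem complexVector_add (X Y X' Y' : V) :
    complexVector X Y + complexVector X' Y' = complexVector (X + X') (Y + Y') := by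
  simp only [complexVector, TensorProduct.tmul_add]
  abel

theorem I_smul_complexVector (X Y : V) :
    Complex.I • complexVector X Y = complexVector (-Y) X := by
  simp only [complexVector, smul_add, TensorProduct.smul_tmul', smul_eq_mul, mul_one,
    Complex.I_mul_I, TensorProduct.neg_tmul, TensorProduct.tmul_neg]
  abel

theorem neg_complexVector (X Y : V) : -complexVector X Y = complexVector (-X) (-Y) := by
  simp only [complexVector, TensorProduct.tmul_neg, neg_add]

@[simp]
theorem baseChange_complexVector (f : V →ₗ[ℝ] V') (X Y : V) :
    LinearMap.baseChange ℂ f (complexVector X Y) = complexVector (f X) (f Y) := by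
  simp [complexVector]

@[simp]
theorem complexConj_complexVector (X Y : V) :
    complexConj V (complexVector X Y) = complexVector X (-Y) := by
  change LinearMap.rTensor V Complex.conjAe.toLinearMap (complexVector X Y) = _
  simp [complexVector, TensorProduct.neg_tmul, TensorProduct.tmul_neg]

theorem complexVector_mem_conjSubmodule {P : Submodule ℂ (ℂ ⊗[ℝ] V)} {X Y : V} :
    complexVector X Y ∈ conjSubmodule P ↔ complexVector X (-Y) ∈ P := by
  rw [conjSubmodule, Submodule.mem_comap, complexConj_complexVector]

theorem baseChange_form_complexVector (B : LinearMap.BilinForm ℝ V) (X Y X' Y' : V) :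
    LinearMap.BilinForm.baseChange ℂ B (complexVector X Y) (complexVector X' Y') =
      ⟨B X X' - B Y Y', B X Y' + B Y X'⟩ := by
  simp only [complexVector, map_add, LinearMap.add_apply,
    LinearMap.BilinForm.baseChange_tmul]
  apply Complex.ext <;> simp [sub_eq_add_neg, add_comm]

theorem baseChange_form_complexVector_eq_zero {B : LinearMap.BilinForm ℝ V} {X Y X' Y' : V} :
    LinearMap.BilinForm.baseChange ℂ B (complexVector X Y) (complexVector X' Y') = 0 ↔
      B X X' = B Y Y' ∧ B X Y' = -B Y X' := by
  rw [baseChange_form_complexVector, Complex.ext_iff]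
  simp [sub_eq_zero, add_eq_zero_iff_eq_neg]

theorem isAlt_baseChange {B : LinearMap.BilinForm ℝ V} (hB : B.IsAlt) :
    (LinearMap.BilinForm.baseChange ℂ B).IsAlt := by
  intro z
  obtain ⟨X, Y, rfl⟩ := exists_complexVector z
  rw [baseChange_form_complexVector_eq_zero, hB, hB]
  exact ⟨rfl, (neg_eq_iff_eq_neg.mp (LinearMap.IsAlt.neg hB X Y))⟩

theorem nondegenerate_baseChange {B : LinearMap.BilinForm ℝ V} (hB : B.IsAlt)
    (h : ∀ X, (∀ Y, B X Y = 0) → X = 0) :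
    (LinearMap.BilinForm.baseChange ℂ B).Nondegenerate := by
  refine LinearMap.IsRefl.nondegenerate_iff_separatingLeft
    (isAlt_baseChange hB).isRefl |>.2 ?_
  intro z hz
  obtain ⟨X, Y, rfl⟩ := exists_complexVector z
  have h1 : ∀ Z, B X Z = 0 ∧ B Y Z = 0 := by
    intro Z
    have h2 := hz (complexVector Z 0)
    rw [baseChange_form_complexVector_eq_zero] at h2
    simp only [map_zero, zero_eq_neg] at h2
    exact h2
  rw [complexVector_eq_zero]
  exact ⟨h X fun Z => (h1 Z).1, h Y fun Z => (h1 Z).2⟩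

end Complexification

section Antiholomorphic

variable (E : Type*) [NormedAddCommGroup E] [NormedSpace ℂ E]

/-- The antiholomorphic vectors in the complexification of a complex vector space: the eigenspace
of multiplication by `i` on `E` for the eigenvalue `-i`. -/
noncomputable def antiholomorphicVectors : Submodule ℂ (ℂ ⊗[ℝ] E) :=
  Module.End.eigenspace
    (LinearMap.baseChange ℂ (almostComplexStructure (E := E) (M := E) 0)) (-Complex.I)

variable {E}

/-- The antiholomorphic vectors are those of the form `X + i J X`. -/
theorem complexVector_mem_antiholomorphicVectors {X Y : E} :
    complexVector X Y ∈ antiholomorphicVectors E ↔ Y = Complex.I • X := by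
  rw [antiholomorphicVectors, Module.End.mem_eigenspace_iff, neg_smul, I_smul_complexVector,
    neg_complexVector]
  erw [baseChange_complexVector]
  rw [complexVector_inj]
  change Complex.I • X = - -Y ∧ Complex.I • Y = -X ↔ _
  rw [neg_neg]
  refine ⟨fun h => h.1.symm, fun h => ⟨h.symm, ?_⟩⟩
  rw [h, smul_smul, Complex.I_mul_I, neg_one_smul]

/-- The holomorphic vectors are those of the form `X - i J X`. -/
theorem complexVector_mem_conj_antiholomorphicVectors {X Y : E} :
    complexVector X Y ∈ conjSubmodule (antiholomorphicVectors E) ↔ Y = -(Complex.I • X) := by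
  rw [complexVector_mem_conjSubmodule, complexVector_mem_antiholomorphicVectors, neg_eq_iff_eq_neg]

end Antiholomorphic

/-! ### Symplectic linear algebra -/

section LinearAlgebra

open LinearMap.BilinForm Module

variable {V : Type*} [AddCommGroup V] [Module ℝ V]
  {W : Type*} [AddCommGroup W] [Module ℝ W]

/-- If `t` and `s` have a common isotropic section and symplectically orthogonal kernels, the
source has twice the dimension of the target: the section gives `≥` and the kernels give `≤`. -/
theorem finrank_eq_two_mul [FiniteDimensional ℝ V] {B : LinearMap.BilinForm ℝ V} (hB : B.IsAlt)
    (hnd : ∀ X, (∀ Y, B X Y = 0) → X = 0) {t s : V →ₗ[ℝ] W} {u : W →ₗ[ℝ] V}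
    (htu : ∀ w, t (u w) = w) (hsu : ∀ w, s (u w) = w)
    (hu : ∀ w w', B (u w) (u w') = 0) (hst : ∀ X Y, s X = 0 → t Y = 0 → B X Y = 0) :
    finrank ℝ V = 2 * finrank ℝ W := by
  have hnd' : B.Nondegenerate :=
    LinearMap.IsRefl.nondegenerate_iff_separatingLeft hB.isRefl |>.2 hnd
  have hW : FiniteDimensional ℝ W :=
    Module.Finite.of_surjective t fun w => ⟨u w, htu w⟩
  have h1 : LinearMap.range u ≤ B.orthogonal (LinearMap.range u) := by
    rintro _ ⟨w, rfl⟩ _ ⟨w', rfl⟩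
    exact hu _ _
  have h2 : LinearMap.ker t ≤ B.orthogonal (LinearMap.ker s) := fun X hX Y hY => hst Y X hY hX
  have h3 := Submodule.finrank_mono h1
  have h4 := Submodule.finrank_mono h2
  rw [finrank_orthogonal hnd'] at h3 h4
  have h5 : finrank ℝ (LinearMap.range u) = finrank ℝ W :=
    LinearMap.finrank_range_of_inj fun a b h => by rw [← htu a, h, htu]
  have h6 := LinearMap.finrank_range_add_finrank_ker t
  have h7 := LinearMap.finrank_range_add_finrank_ker s
  rw [LinearMap.range_eq_top.2 fun w => ⟨u w, htu w⟩, finrank_top] at h6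
  rw [LinearMap.range_eq_top.2 fun w => ⟨u w, hsu w⟩, finrank_top] at h7
  have h8 : finrank ℝ (LinearMap.range u) ≤ finrank ℝ V := Submodule.finrank_le _
  omega

/-- Two symplectically orthogonal subspaces of half the dimension are each other's orthogonals,
here for the kernels of `t` and `s`. -/
theorem apply_eq_zero_of_forall_ker [FiniteDimensional ℝ V] {B : LinearMap.BilinForm ℝ V}
    (hB : B.IsAlt) (hnd : ∀ X, (∀ Y, B X Y = 0) → X = 0) {t s : V →ₗ[ℝ] W}
    (ht : Function.Surjective t) (hs : Function.Surjective s)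
    (hdim : finrank ℝ V = 2 * finrank ℝ W) (hst : ∀ X Y, s X = 0 → t Y = 0 → B X Y = 0)
    {X : V} (hX : ∀ Y, t Y = 0 → B X Y = 0) : s X = 0 := by
  have hnd' : B.Nondegenerate :=
    LinearMap.IsRefl.nondegenerate_iff_separatingLeft hB.isRefl |>.2 hnd
  have h2 : LinearMap.ker s ≤ B.orthogonal (LinearMap.ker t) :=
    fun X hX Y hY => hB.isRefl _ _ (hst X Y hX hY)
  have h6 := LinearMap.finrank_range_add_finrank_ker t
  have h7 := LinearMap.finrank_range_add_finrank_ker s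
  rw [LinearMap.range_eq_top.2 ht, finrank_top] at h6
  rw [LinearMap.range_eq_top.2 hs, finrank_top] at h7
  have h3 := Submodule.eq_of_le_of_finrank_eq h2 (by
    rw [finrank_orthogonal hnd']
    omega)
  have : X ∈ LinearMap.ker s := by
    rw [h3]
    exact fun Y hY => hB.isRefl _ _ (hX Y hY)
  exact this

theorem orthogonal_inf_eq_sup {K U : Type*} [Field K] [AddCommGroup U] [Module K U]
    [FiniteDimensional K U] {B : LinearMap.BilinForm K U} (hB : B.IsRefl) (hnd : B.Nondegenerate)
    (A A' : Submodule K U) :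
    B.orthogonal (A ⊓ A') = B.orthogonal A ⊔ B.orthogonal A' := by
  rw [← orthogonal_orthogonal hnd hB (B.orthogonal A ⊔ B.orthogonal A')]
  apply le_antisymm <;> apply orthogonal_le
  · refine le_inf ?_ ?_
    · rw [← orthogonal_orthogonal hnd hB A]
      exact orthogonal_le (by simp [orthogonal_orthogonal hnd hB])
    · rw [← orthogonal_orthogonal hnd hB A']
      exact orthogonal_le (by simp [orthogonal_orthogonal hnd hB])
  · rintro X ⟨hX, hX'⟩ Y hY
    obtain ⟨Z, hZ, Z', hZ', rfl⟩ := Submodule.mem_sup.1 hY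
    rw [map_add, LinearMap.add_apply, hB _ _ (hZ X hX), hB _ _ (hZ' X hX'), add_zero]

end LinearAlgebra

section Polarization

open LinearMap.BilinForm Module

variable {V : Type*} [AddCommGroup V] [Module ℝ V]
  {E : Type*} [NormedAddCommGroup E] [NormedSpace ℂ E]

/-- The complex subspace of `ℂ ⊗ V` of the vectors that `t` takes to antiholomorphic and `s` to
holomorphic vectors. -/
noncomputable def polarizationSubspace (t s : V →ₗ[ℝ] E) : Submodule ℂ (ℂ ⊗[ℝ] V) :=
  (antiholomorphicVectors E).comap (LinearMap.baseChange ℂ t) ⊓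
    (conjSubmodule (antiholomorphicVectors E)).comap (LinearMap.baseChange ℂ s)

theorem complexVector_mem_polarizationSubspace {t s : V →ₗ[ℝ] E} {X Y : V} :
    complexVector X Y ∈ polarizationSubspace t s ↔
      t Y = Complex.I • t X ∧ s Y = -(Complex.I • s X) := by
  rw [polarizationSubspace, Submodule.mem_inf, Submodule.mem_comap, Submodule.mem_comap,
    baseChange_complexVector, baseChange_complexVector, complexVector_mem_antiholomorphicVectors,
    complexVector_mem_conj_antiholomorphicVectors]

/-- If `t` and `s` have a common section, the polarization subspace is the kernel of a surjective
map onto `ℂ ⊗ E`: the sum of the holomorphic part of `t` and the antiholomorphic part of `s`. -/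
theorem finrank_polarizationSubspace_of_section [FiniteDimensional ℝ V] {t s : V →ₗ[ℝ] E}
    {u : E →ₗ[ℝ] V} (htu : ∀ w, t (u w) = w) (hsu : ∀ w, s (u w) = w) :
    finrank ℂ (polarizationSubspace t s) + finrank ℝ E = finrank ℝ V := by
  have hE : FiniteDimensional ℝ E := Module.Finite.of_surjective t fun w => ⟨u w, htu w⟩
  let J : E →ₗ[ℝ] E := (LinearMap.lsmul ℂ E Complex.I).restrictScalars ℝ
  -- Twice the sum of the two projections: `1 - iJ` and `1 + iJ` are twice the projections to the
  -- `i`- and the `-i`-eigenspace of `J`.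
  let q : (ℂ ⊗[ℝ] V) →ₗ[ℂ] (ℂ ⊗[ℝ] E) :=
    LinearMap.baseChange ℂ t - Complex.I • LinearMap.baseChange ℂ (J ∘ₗ t) +
      (LinearMap.baseChange ℂ s + Complex.I • LinearMap.baseChange ℂ (J ∘ₗ s))
  have hq : ∀ X Y, q (complexVector X Y) =
      complexVector (t X + Complex.I • t Y + (s X - Complex.I • s Y))
        (t Y - Complex.I • t X + (s Y + Complex.I • s X)) := by
    intro X Y
    simp only [q, LinearMap.add_apply, LinearMap.sub_apply, LinearMap.smul_apply,
      baseChange_complexVector, I_smul_complexVector]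
    simp only [sub_eq_add_neg, neg_complexVector, complexVector_add, neg_neg]
    rfl
  have hker : LinearMap.ker q = polarizationSubspace t s := by
    ext Z
    obtain ⟨X, Y, rfl⟩ := exists_complexVector Z
    rw [LinearMap.mem_ker, hq, complexVector_eq_zero, complexVector_mem_polarizationSubspace]
    have hI : ∀ w : E, Complex.I • Complex.I • w = -w := fun w => by
      rw [smul_smul, Complex.I_mul_I, neg_one_smul]
    constructor
    · rintro ⟨h1, h2⟩
      have h3 := congrArg (Complex.I • ·) h1
      simp only [smul_add, smul_sub, hI, smul_zero] at h3
      constructor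
      · have h4 : (2 : ℝ) • (t Y - Complex.I • t X) = 0 := by
          linear_combination (norm := module) h2 - h3
        rw [smul_eq_zero_iff_right two_ne_zero, sub_eq_zero] at h4
        exact h4
      · have h4 : (2 : ℝ) • (s Y + Complex.I • s X) = 0 := by
          linear_combination (norm := module) h2 + h3
        rw [smul_eq_zero_iff_right two_ne_zero, add_eq_zero_iff_eq_neg] at h4
        exact h4
    · rintro ⟨h1, h2⟩
      rw [h1, h2, smul_neg, hI, hI]
      constructor <;> abel
  have hsurj : Function.Surjective q := by
    intro Z
    obtain ⟨X, Y, rfl⟩ := exists_complexVector Z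
    refine ⟨complexVector (u ((1 / 2 : ℝ) • X)) (u ((1 / 2 : ℝ) • Y)), ?_⟩
    rw [hq, complexVector_inj, htu, htu, hsu, hsu]
    constructor <;> module
  have h := LinearMap.finrank_range_add_finrank_ker q
  rw [hker, LinearMap.range_eq_top.2 hsurj, finrank_top, Module.finrank_baseChange,
    Module.finrank_baseChange] at h
  omega

/-- The Hamiltonian vectors of the pullbacks by `t` of any two complex linear functionals are
orthogonal for the complexified form `B`. -/
def PullbackInvolution (B : LinearMap.BilinForm ℝ V) (t : V →ₗ[ℝ] E) : Prop :=
  ∀ (α β : E →L[ℂ] ℂ) (X X' Y Y' : V),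
    (∀ Z, B X Z = (α (t Z)).re) → (∀ Z, B X' Z = (α (t Z)).im) →
    (∀ Z, B Y Z = (β (t Z)).re) → (∀ Z, B Y' Z = (β (t Z)).im) →
    B X Y = B X' Y' ∧ B X Y' = -B X' Y

/-- The preimage under `t` of the antiholomorphic vectors is coisotropic, and its orthogonal is
contained in the kernel of `s`. -/
theorem coisotropic_preimage_antiholomorphic [FiniteDimensional ℝ V] [FiniteDimensional ℂ E]
    {B : LinearMap.BilinForm ℝ V} (hB : B.IsAlt) (hnd : ∀ X, (∀ Y, B X Y = 0) → X = 0)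
    {t s : V →ₗ[ℝ] E} (ht : Function.Surjective t)
    (horth : ∀ X, (∀ Y, t Y = 0 → B X Y = 0) → s X = 0) (hinv : PullbackInvolution B t)
    {X X' : V}
    (hX : ∀ Y Y', t Y' = Complex.I • t Y → B X Y = B X' Y' ∧ B X Y' = -B X' Y) :
    t X' = Complex.I • t X ∧ s X = 0 ∧ s X' = 0 := by
  have hI : ∀ w : E, Complex.I • Complex.I • w = -w := fun w => by
    rw [smul_smul, Complex.I_mul_I, neg_one_smul]
  have hX0 : ∀ Y, t Y = 0 → B X Y = 0 := fun Y hY => by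
    have := hX Y 0 (by simp [hY])
    simpa using this.1
  have hX0' : ∀ Y, t Y = 0 → B X' Y = 0 := fun Y hY => by
    have := hX Y 0 (by simp [hY])
    simpa using this.2
  refine ⟨?_, horth X hX0, horth X' hX0'⟩
  obtain ⟨σ, hσ⟩ := t.exists_rightInverse_of_surjective (LinearMap.range_eq_top.2 ht)
  have hσ' : ∀ w, t (σ w) = w := fun w => LinearMap.congr_fun hσ w
  -- The two functionals factor through `t`, and together form a complex linear functional.
  let α : E →ₗ[ℂ] ℂ :=
    { toFun := fun w => ⟨B X (σ w), B X' (σ w)⟩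
      map_add' := fun v w => by apply Complex.ext <;> simp
      map_smul' := fun c w => by
        have h1 := hX (σ w) (σ (Complex.I • w)) (by rw [hσ', hσ'])
        have h2 : c • w = c.re • w + c.im • Complex.I • w := by
          conv_lhs => rw [← Complex.re_add_im c, add_smul, mul_smul]
          simp
        rw [h2]
        apply Complex.ext
        · simp [h1.2]
          ring
        · simp [h1.1] }
  have hα : ∀ Z, B X Z = (α (t Z)).re ∧ B X' Z = (α (t Z)).im := by
    intro Z
    have h1 : t (Z - σ (t Z)) = 0 := by rw [map_sub, hσ', sub_self]
    have h2 := hX0 _ h1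
    have h3 := hX0' _ h1
    rw [map_sub, sub_eq_zero] at h2 h3
    exact ⟨h2, h3⟩
  have hnd' : B.Nondegenerate :=
    LinearMap.IsRefl.nondegenerate_iff_separatingLeft hB.isRefl |>.2 hnd
  -- It suffices to test against complex linear functionals `β`, where `Y` and `Y'` below are the
  -- Hamiltonian vectors of the real and the imaginary part of `β ∘ t`.
  have h0 : t X + Complex.I • t X' = 0 := by
    rw [← Module.forall_dual_apply_eq_zero_iff ℂ]
    intro β
    let β₁ : Module.Dual ℝ V := Complex.reLm ∘ₗ β.restrictScalars ℝ ∘ₗ t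
    let β₂ : Module.Dual ℝ V := Complex.imLm ∘ₗ β.restrictScalars ℝ ∘ₗ t
    have hY : ∀ Z, B ((B.toDual hnd').symm β₁) Z = (β (t Z)).re := fun Z => by
      rw [apply_toDual_symm_apply]
      rfl
    have hY' : ∀ Z, B ((B.toDual hnd').symm β₂) Z = (β (t Z)).im := fun Z => by
      rw [apply_toDual_symm_apply]
      rfl
    obtain ⟨h1, h2⟩ := hinv (LinearMap.toContinuousLinearMap α) (LinearMap.toContinuousLinearMap β)
      X X' _ _ (fun Z => (hα Z).1) (fun Z => (hα Z).2) hY hY'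
    have hswap : ∀ Z Z', B Z Z' = -B Z' Z := fun Z Z' => (LinearMap.IsAlt.neg hB Z' Z).symm
    rw [hswap X, hswap X', hY, hY'] at h1
    rw [hswap X, hswap X', hY, hY'] at h2
    rw [map_add, map_smul]
    apply Complex.ext
    · simp
      linarith
    · simp
      linarith
  have h1 := congrArg (Complex.I • ·) h0
  simp only [smul_add, hI, smul_zero] at h1
  exact (add_neg_eq_zero.1 h1).symm

/-- The orthogonal of the intersection that defines the polarization subspace is the sum of the
orthogonals, and each of these lies in the polarization subspace and in one of the kernels. -/
theorem orthogonal_polarizationSubspace_le [FiniteDimensional ℝ V] [FiniteDimensional ℂ E]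
    {B : LinearMap.BilinForm ℝ V} (hB : B.IsAlt) (hnd : ∀ X, (∀ Y, B X Y = 0) → X = 0)
    {t s : V →ₗ[ℝ] E} (ht : Function.Surjective t) (hs : Function.Surjective s)
    (horth : ∀ X, (∀ Y, t Y = 0 → B X Y = 0) → s X = 0)
    (horth' : ∀ X, (∀ Y, s Y = 0 → B X Y = 0) → t X = 0)
    (hinv : PullbackInvolution B t) (hinv' : PullbackInvolution B s) :
    (LinearMap.BilinForm.baseChange ℂ B).orthogonal (polarizationSubspace t s) ≤
      (polarizationSubspace t s ⊓ LinearMap.ker (LinearMap.baseChange ℂ s)) ⊔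
        (polarizationSubspace t s ⊓ LinearMap.ker (LinearMap.baseChange ℂ t)) := by
  have hrefl := (isAlt_baseChange hB).isRefl
  rw [polarizationSubspace, orthogonal_inf_eq_sup hrefl (nondegenerate_baseChange hB hnd)]
  rw [← polarizationSubspace]
  apply sup_le_sup
  · intro Z hZ
    obtain ⟨X, X', rfl⟩ := exists_complexVector Z
    obtain ⟨h1, h2, h3⟩ := coisotropic_preimage_antiholomorphic hB hnd ht horth hinv
      (X := X) (X' := X') fun Y Y' hY => by
        have := hrefl _ _ (hZ (complexVector Y Y') (by
          rwa [Submodule.mem_comap, baseChange_complexVector,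
            complexVector_mem_antiholomorphicVectors]))
        rwa [baseChange_form_complexVector_eq_zero] at this
    rw [Submodule.mem_inf, complexVector_mem_polarizationSubspace, LinearMap.mem_ker,
      baseChange_complexVector, h2, h3]
    simp [h1]
  · -- The form is real, so this is the complex conjugate of the first case, for `s`.
    intro Z hZ
    obtain ⟨X, X', rfl⟩ := exists_complexVector Z
    obtain ⟨h1, h2, h3⟩ := coisotropic_preimage_antiholomorphic hB hnd hs horth' hinv'
      (X := X) (X' := -X') fun Y Y' hY => by
        have := hrefl _ _ (hZ (complexVector Y (-Y')) (by
          rw [Submodule.mem_comap, baseChange_complexVector,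
            complexVector_mem_conj_antiholomorphicVectors, map_neg, hY]))
        rw [baseChange_form_complexVector_eq_zero] at this
        simpa [neg_eq_iff_eq_neg] using this
    rw [map_neg, neg_eq_zero] at h3
    rw [map_neg, neg_eq_iff_eq_neg] at h1
    rw [Submodule.mem_inf, complexVector_mem_polarizationSubspace, LinearMap.mem_ker,
      baseChange_complexVector, h2, h3]
    simp [h1]

/-- The orthogonal of the polarization subspace is contained in it, and hence equal to it by
dimension. -/
theorem orthogonal_polarizationSubspace_eq [FiniteDimensional ℝ V] [FiniteDimensional ℂ E]
    {B : LinearMap.BilinForm ℝ V} (hB : B.IsAlt) (hnd : ∀ X, (∀ Y, B X Y = 0) → X = 0)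
    {t s : V →ₗ[ℝ] E} (ht : Function.Surjective t) (hs : Function.Surjective s)
    (horth : ∀ X, (∀ Y, t Y = 0 → B X Y = 0) → s X = 0)
    (horth' : ∀ X, (∀ Y, s Y = 0 → B X Y = 0) → t X = 0)
    (hinv : PullbackInvolution B t) (hinv' : PullbackInvolution B s)
    (hdim : finrank ℝ V = 2 * finrank ℂ (polarizationSubspace t s)) :
    (LinearMap.BilinForm.baseChange ℂ B).orthogonal (polarizationSubspace t s) =
      polarizationSubspace t s := by
  refine Submodule.eq_of_le_of_finrank_eq
    ((orthogonal_polarizationSubspace_le hB hnd ht hs horth horth' hinv hinv').trans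
      (sup_le inf_le_left inf_le_left)) ?_
  rw [finrank_orthogonal (nondegenerate_baseChange hB hnd), Module.finrank_baseChange]
  omega

end Polarization

/-! ### Lie brackets in charts -/

section Brackets

variable {F H : Type*} [NormedAddCommGroup F] [NormedSpace ℝ F]
  [NormedAddCommGroup H] [NormedSpace ℝ H]

theorem fderiv_apply_lieBracket {Φ : F → H} {x : F} (hΦ : ContDiffAt ℝ 2 Φ x) {V W : F → F}
    (hV : DifferentiableAt ℝ V x) (hW : DifferentiableAt ℝ W x) :
    fderiv ℝ Φ x (lieBracket ℝ V W x) =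
      fderiv ℝ (fun y => fderiv ℝ Φ y (W y)) x (V x) -
        fderiv ℝ (fun y => fderiv ℝ Φ y (V y)) x (W x) := by
  have h1 : DifferentiableAt ℝ (fderiv ℝ Φ) x :=
    (hΦ.fderiv_right (m := 1) (by norm_num)).differentiableAt (by norm_num)
  have h2 : IsSymmSndFDerivAt ℝ Φ x := hΦ.isSymmSndFDerivAt (by simp)
  rw [fderiv_clm_apply h1 hW, fderiv_clm_apply h1 hV, lieBracket]
  simp [h2.eq (V x) (W x)]

variable {M : Type*} [TopologicalSpace M] [ChartedSpace F M]

variable (F) in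
/-- The expression of a vector field in the preferred chart at `x`, as a map of the model space. -/
noncomputable def chartField (x : M) (V : ∀ y : M, TangentSpace 𝓘(ℝ, F) y) (z : F) : F :=
  mpullbackWithin 𝓘(ℝ, F) 𝓘(ℝ, F) (extChartAt 𝓘(ℝ, F) x).symm V (Set.range 𝓘(ℝ, F)) z

theorem fderiv_comp_extChartAt_symm_chartField [IsManifold 𝓘(ℝ, F) ∞ M] {Φ : M → H} {x : M}
    (hΦ : ∀ᶠ y in nhds x, MDifferentiableAt 𝓘(ℝ, F) 𝓘(ℝ, H) Φ y)
    (V : ∀ y : M, TangentSpace 𝓘(ℝ, F) y) :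
    ∀ᶠ z in nhds (extChartAt 𝓘(ℝ, F) x x),
      fderiv ℝ (Φ ∘ (extChartAt 𝓘(ℝ, F) x).symm) z
        (chartField F x V z) =
      mvfderiv 𝓘(ℝ, F) Φ ((extChartAt 𝓘(ℝ, F) x).symm z)
        (V ((extChartAt 𝓘(ℝ, F) x).symm z)) := by
  have h1 : (extChartAt 𝓘(ℝ, F) x).target ∈ nhds (extChartAt 𝓘(ℝ, F) x x) :=
    extChartAt_target_mem_nhds x
  have h2 : Filter.Tendsto (extChartAt 𝓘(ℝ, F) x).symm (nhds (extChartAt 𝓘(ℝ, F) x x))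
      (nhds x) := by
    have := continuousAt_extChartAt_symm (I := 𝓘(ℝ, F)) x
    rwa [ContinuousAt, extChartAt_to_inv] at this
  filter_upwards [h1, h2.eventually hΦ] with z hz hz'
  have h3 : (mfderivWithin 𝓘(ℝ, F) 𝓘(ℝ, F) (extChartAt 𝓘(ℝ, F) x).symm (Set.range 𝓘(ℝ, F))
      z).IsInvertible := isInvertible_mfderivWithin_extChartAt_symm (I := 𝓘(ℝ, F)) hz
  have h4 := mdifferentiableWithinAt_extChartAt_symm (I := 𝓘(ℝ, F)) hz
  have h5 := hz'.hasMFDerivAt.comp_hasMFDerivWithinAt z h4.hasMFDerivWithinAt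
  obtain ⟨e, he⟩ := h3
  rw [← he] at h5
  have h6 : HasMFDerivAt 𝓘(ℝ, F) 𝓘(ℝ, H) (Φ ∘ (extChartAt 𝓘(ℝ, F) x).symm) z
      ((mfderiv 𝓘(ℝ, F) 𝓘(ℝ, H) Φ ((extChartAt 𝓘(ℝ, F) x).symm z)).comp
        (e : TangentSpace 𝓘(ℝ, F) z →L[ℝ]
          TangentSpace 𝓘(ℝ, F) ((extChartAt 𝓘(ℝ, F) x).symm z))) := by
    rw [← hasMFDerivWithinAt_univ]
    rwa [modelWithCornersSelf_coe, Set.range_id] at h5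
  let L : F →L[ℝ] H := mfderiv 𝓘(ℝ, F) 𝓘(ℝ, H) Φ ((extChartAt 𝓘(ℝ, F) x).symm z)
  let A : F ≃L[ℝ] F := e
  have h7 : HasFDerivAt (Φ ∘ (extChartAt 𝓘(ℝ, F) x).symm) (L.comp (A : F →L[ℝ] F)) z :=
    hasMFDerivAt_iff_hasFDerivAt.1 h6
  have h8 : chartField F x V z = A.symm (V ((extChartAt 𝓘(ℝ, F) x).symm z)) := by
    rw [chartField, mpullbackWithin_apply, ← he, ContinuousLinearMap.inverse_equiv]
    rfl
  have h9 : ∀ Y Z : F, Y = A.symm Z →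
      fderiv ℝ (Φ ∘ (extChartAt 𝓘(ℝ, F) x).symm) z Y = L Z := by
    rintro _ Z rfl
    rw [h7.fderiv]
    exact congrArg L (A.apply_symm_apply Z)
  exact h9 _ _ h8

theorem fderiv_comp_extChartAt_symm {Φ : M → H} {x : M}
    (hΦ : MDifferentiableAt 𝓘(ℝ, F) 𝓘(ℝ, H) Φ x) :
    fderiv ℝ (Φ ∘ (extChartAt 𝓘(ℝ, F) x).symm) (extChartAt 𝓘(ℝ, F) x x) =
      mvfderiv 𝓘(ℝ, F) Φ x := by
  have h := hΦ.mfderiv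
  rw [modelWithCornersSelf_coe, Set.range_id, fderivWithin_univ] at h
  exact h.symm

theorem contDiffAt_comp_extChartAt_symm {Φ : M → H} {x : M} {n : ℕ∞ω}
    (hΦ : ContMDiffAt 𝓘(ℝ, F) 𝓘(ℝ, H) n Φ x) :
    ContDiffAt ℝ n (Φ ∘ (extChartAt 𝓘(ℝ, F) x).symm) (extChartAt 𝓘(ℝ, F) x x) := by
  have := (contMDiffAt_iff.1 hΦ).2
  rwa [modelWithCornersSelf_coe, Set.range_id] at this

theorem tendsto_extChartAt_symm (x : M) :
    Filter.Tendsto (extChartAt 𝓘(ℝ, F) x).symm (nhds (extChartAt 𝓘(ℝ, F) x x)) (nhds x) := by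
  have := continuousAt_extChartAt_symm (I := 𝓘(ℝ, F)) x
  rwa [ContinuousAt, extChartAt_to_inv] at this

variable [IsManifold 𝓘(ℝ, F) ∞ M]

theorem differentiableAt_chartField [CompleteSpace F] {x : M}
    {V : ∀ y : M, TangentSpace 𝓘(ℝ, F) y}
    (hV : MDifferentiableAt 𝓘(ℝ, F) 𝓘(ℝ, F).tangent
      (fun y => (⟨y, V y⟩ : TangentBundle 𝓘(ℝ, F) M)) x) :
    DifferentiableAt ℝ (chartField F x V) (extChartAt 𝓘(ℝ, F) x x) := by
  have h := (mdifferentiableWithinAt_univ.2 hV).differentiableWithinAt_mpullbackWithin_vectorField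
  have h' : DifferentiableWithinAt ℝ (chartField F x V) ((extChartAt 𝓘(ℝ, F) x).symm ⁻¹' Set.univ ∩
      Set.range 𝓘(ℝ, F)) (extChartAt 𝓘(ℝ, F) x x) := h
  rwa [modelWithCornersSelf_coe, Set.range_id, Set.preimage_univ, Set.univ_inter,
    differentiableWithinAt_univ] at h'

theorem mlieBracket_eq_lieBracket_chartField (x : M) (V W : ∀ y : M, TangentSpace 𝓘(ℝ, F) y) :
    (mlieBracket 𝓘(ℝ, F) V W x : F) =
      lieBracket ℝ (chartField F x V) (chartField F x W) (extChartAt 𝓘(ℝ, F) x x) := by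
  have h1 : (mfderiv 𝓘(ℝ, F) 𝓘(ℝ, F) (extChartAt 𝓘(ℝ, F) x) x : F →L[ℝ] F) =
      ContinuousLinearMap.id ℝ F := mfderiv_extChartAt_self
  have h2 : ∀ (A : F →L[ℝ] F) (Z : F), A = ContinuousLinearMap.id ℝ F → A.inverse Z = Z := by
    rintro _ Z rfl
    rw [ContinuousLinearMap.inverse_id]
    rfl
  have h3 : (mlieBracket 𝓘(ℝ, F) V W x : F) =
      lieBracketWithin ℝ (chartField F x V) (chartField F x W)
        ((extChartAt 𝓘(ℝ, F) x).symm ⁻¹' Set.univ ∩ Set.range 𝓘(ℝ, F))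
        (extChartAt 𝓘(ℝ, F) x x) := h2 _ _ h1
  rwa [modelWithCornersSelf_coe, Set.range_id, Set.preimage_univ, Set.univ_inter,
    lieBracketWithin_univ] at h3

theorem eventually_fderiv_chartField {Φ : M → H} {x : M}
    (hΦ : ContMDiffAt 𝓘(ℝ, F) 𝓘(ℝ, H) 2 Φ x) (V : ∀ y : M, TangentSpace 𝓘(ℝ, F) y) :
    (fun z => fderiv ℝ (Φ ∘ (extChartAt 𝓘(ℝ, F) x).symm) z (chartField F x V z))
      =ᶠ[nhds (extChartAt 𝓘(ℝ, F) x x)]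
        ((fun y => mvfderiv 𝓘(ℝ, F) Φ y (V y)) ∘ (extChartAt 𝓘(ℝ, F) x).symm) := by
  refine fderiv_comp_extChartAt_symm_chartField ?_ V
  filter_upwards [(contMDiffAt_iff_contMDiffAt_nhds (by simp)).1 hΦ] with y hy
  exact hy.mdifferentiableAt (by simp)

/-- A Lie bracket acts on functions as the commutator of derivations, here in a chart: `Φ` is
differentiated along `[V, W]`. -/
theorem mvfderiv_mlieBracket [CompleteSpace F] {Φ : M → H} {x : M}
    (hΦ : ContMDiffAt 𝓘(ℝ, F) 𝓘(ℝ, H) 2 Φ x)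
    {V W : ∀ y : M, TangentSpace 𝓘(ℝ, F) y}
    (hV : MDifferentiableAt 𝓘(ℝ, F) 𝓘(ℝ, F).tangent
      (fun y => (⟨y, V y⟩ : TangentBundle 𝓘(ℝ, F) M)) x)
    (hW : MDifferentiableAt 𝓘(ℝ, F) 𝓘(ℝ, F).tangent
      (fun y => (⟨y, W y⟩ : TangentBundle 𝓘(ℝ, F) M)) x) :
    mvfderiv 𝓘(ℝ, F) Φ x (mlieBracket 𝓘(ℝ, F) V W x) =
      fderiv ℝ ((fun y => mvfderiv 𝓘(ℝ, F) Φ y (W y)) ∘ (extChartAt 𝓘(ℝ, F) x).symm)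
          (extChartAt 𝓘(ℝ, F) x x) (chartField F x V (extChartAt 𝓘(ℝ, F) x x)) -
        fderiv ℝ ((fun y => mvfderiv 𝓘(ℝ, F) Φ y (V y)) ∘ (extChartAt 𝓘(ℝ, F) x).symm)
          (extChartAt 𝓘(ℝ, F) x x) (chartField F x W (extChartAt 𝓘(ℝ, F) x x)) := by
  have h4 := fderiv_apply_lieBracket (contDiffAt_comp_extChartAt_symm hΦ)
    (differentiableAt_chartField hV) (differentiableAt_chartField hW)
  have h5 := fderiv_comp_extChartAt_symm (hΦ.mdifferentiableAt (by simp))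
  refine (DFunLike.congr h5.symm (mlieBracket_eq_lieBracket_chartField x V W)).trans
    (h4.trans ?_)
  rw [(eventually_fderiv_chartField hΦ V).fderiv_eq, (eventually_fderiv_chartField hΦ W).fderiv_eq]

theorem differentiableAt_mvfderiv_comp_extChartAt_symm [CompleteSpace F] {Φ : M → H} {x : M}
    (hΦ : ContMDiffAt 𝓘(ℝ, F) 𝓘(ℝ, H) 2 Φ x) {V : ∀ y : M, TangentSpace 𝓘(ℝ, F) y}
    (hV : MDifferentiableAt 𝓘(ℝ, F) 𝓘(ℝ, F).tangent
      (fun y => (⟨y, V y⟩ : TangentBundle 𝓘(ℝ, F) M)) x) :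
    DifferentiableAt ℝ ((fun y => mvfderiv 𝓘(ℝ, F) Φ y (V y)) ∘ (extChartAt 𝓘(ℝ, F) x).symm)
      (extChartAt 𝓘(ℝ, F) x x) := by
  have h3 : DifferentiableAt ℝ (fderiv ℝ (Φ ∘ (extChartAt 𝓘(ℝ, F) x).symm))
      (extChartAt 𝓘(ℝ, F) x x) :=
    ((contDiffAt_comp_extChartAt_symm hΦ).fderiv_right (m := 1) (by norm_num)).differentiableAt
      (by norm_num)
  exact (h3.clm_apply (differentiableAt_chartField hV)).congr_of_eventuallyEq
    (eventually_fderiv_chartField hΦ V).symm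

/-- The complex vector fields `X₁ + i X₂` with `dΦ(X₂) = J dΦ(X₁)`, that is, those that `Φ` takes
to `-i`-eigenvectors of a constant complex structure `J`, are closed under the Lie bracket. -/
theorem mvfderiv_complex_mlieBracket [CompleteSpace F] {Φ : M → H} {x : M}
    (hΦ : ContMDiffAt 𝓘(ℝ, F) 𝓘(ℝ, H) 2 Φ x) {J : H →L[ℝ] H} (hJ : ∀ v, J (J v) = -v)
    {X₁ X₂ Y₁ Y₂ : ∀ y : M, TangentSpace 𝓘(ℝ, F) y}
    (hX₁ : MDifferentiableAt 𝓘(ℝ, F) 𝓘(ℝ, F).tangent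
      (fun y => (⟨y, X₁ y⟩ : TangentBundle 𝓘(ℝ, F) M)) x)
    (hX₂ : MDifferentiableAt 𝓘(ℝ, F) 𝓘(ℝ, F).tangent
      (fun y => (⟨y, X₂ y⟩ : TangentBundle 𝓘(ℝ, F) M)) x)
    (hY₁ : MDifferentiableAt 𝓘(ℝ, F) 𝓘(ℝ, F).tangent
      (fun y => (⟨y, Y₁ y⟩ : TangentBundle 𝓘(ℝ, F) M)) x)
    (hY₂ : MDifferentiableAt 𝓘(ℝ, F) 𝓘(ℝ, F).tangent
      (fun y => (⟨y, Y₂ y⟩ : TangentBundle 𝓘(ℝ, F) M)) x)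
    (hX : ∀ᶠ y in nhds x, mvfderiv 𝓘(ℝ, F) Φ y (X₂ y) = J (mvfderiv 𝓘(ℝ, F) Φ y (X₁ y)))
    (hY : ∀ᶠ y in nhds x, mvfderiv 𝓘(ℝ, F) Φ y (Y₂ y) = J (mvfderiv 𝓘(ℝ, F) Φ y (Y₁ y))) :
    mvfderiv 𝓘(ℝ, F) Φ x (mlieBracket 𝓘(ℝ, F) X₁ Y₂ x + mlieBracket 𝓘(ℝ, F) X₂ Y₁ x) =
      J (mvfderiv 𝓘(ℝ, F) Φ x
        (mlieBracket 𝓘(ℝ, F) X₁ Y₁ x - mlieBracket 𝓘(ℝ, F) X₂ Y₂ x)) := by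
  have h2 : ∀ {Z₁ Z₂ : ∀ y : M, TangentSpace 𝓘(ℝ, F) y},
      MDifferentiableAt 𝓘(ℝ, F) 𝓘(ℝ, F).tangent
        (fun y => (⟨y, Z₁ y⟩ : TangentBundle 𝓘(ℝ, F) M)) x →
      (∀ᶠ y in nhds x, mvfderiv 𝓘(ℝ, F) Φ y (Z₂ y) = J (mvfderiv 𝓘(ℝ, F) Φ y (Z₁ y))) →
      ∀ v, fderiv ℝ ((fun y => mvfderiv 𝓘(ℝ, F) Φ y (Z₂ y)) ∘ (extChartAt 𝓘(ℝ, F) x).symm)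
          (extChartAt 𝓘(ℝ, F) x x) v =
        J (fderiv ℝ ((fun y => mvfderiv 𝓘(ℝ, F) Φ y (Z₁ y)) ∘ (extChartAt 𝓘(ℝ, F) x).symm)
          (extChartAt 𝓘(ℝ, F) x x) v) := by
    intro Z₁ Z₂ hZ₁ hZ v
    have h3 := (J.hasFDerivAt.comp _
      (differentiableAt_mvfderiv_comp_extChartAt_symm hΦ hZ₁).hasFDerivAt).congr_of_eventuallyEq
        ((tendsto_extChartAt_symm x).eventually hZ)
    exact DFunLike.congr_fun h3.fderiv v
  rw [map_add, map_sub, mvfderiv_mlieBracket hΦ hX₁ hY₂, mvfderiv_mlieBracket hΦ hX₂ hY₁,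
    mvfderiv_mlieBracket hΦ hX₁ hY₁, mvfderiv_mlieBracket hΦ hX₂ hY₂]
  rw [h2 hY₁ hY, h2 hX₁ hX, h2 hY₁ hY, h2 hX₁ hX]
  simp only [map_sub, hJ]
  abel

end Brackets

/-! ### Local sections of submersions -/

section Sections

variable {F : Type*} [NormedAddCommGroup F] [NormedSpace ℝ F]
  {G : Type*} [TopologicalSpace G] [ChartedSpace F G]
  {E : Type*} [NormedAddCommGroup E] [NormedSpace ℝ E] [FiniteDimensional ℝ E]
  {M : Type*} [TopologicalSpace M] [ChartedSpace E M]

/-- A submersion onto a finite-dimensional manifold has a local section through every point; it is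
obtained from the inverse function theorem, applied to the submersion along a complement of the
kernel of its derivative. -/
theorem exists_local_section [IsManifold 𝓘(ℝ, F) ∞ G] [IsManifold 𝓘(ℝ, E) ∞ M]
    {f : G → M} {g : G} (hf : ContMDiffAt 𝓘(ℝ, F) 𝓘(ℝ, E) ∞ f g)
    (hs : Function.Surjective (mfderiv 𝓘(ℝ, F) 𝓘(ℝ, E) f g)) :
    ∃ b : M → G, b (f g) = g ∧ MDifferentiableAt 𝓘(ℝ, E) 𝓘(ℝ, F) b (f g) ∧
      ∀ᶠ x in nhds (f g), f (b x) = x := by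
  have hE : CompleteSpace E := FiniteDimensional.complete ℝ E
  set φ := extChartAt 𝓘(ℝ, F) g with hφ
  set ψ := extChartAt 𝓘(ℝ, E) (f g) with hψ
  set f' : F → E := ψ ∘ f ∘ φ.symm with hf'
  have h1 : ContDiffAt ℝ ∞ f' (φ g) := by
    have := (contMDiffAt_iff.1 hf).2
    rw [modelWithCornersSelf_coe, Set.range_id] at this
    exact this
  have h2 : HasStrictFDerivAt f' (fderiv ℝ f' (φ g)) (φ g) := h1.hasStrictFDerivAt (by simp)
  have h3 : mfderiv 𝓘(ℝ, F) 𝓘(ℝ, E) f g = fderiv ℝ f' (φ g) := by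
    rw [(hf.mdifferentiableAt (by simp)).mfderiv]
    rw [modelWithCornersSelf_coe, Set.range_id, fderivWithin_univ]
    rfl
  rw [h3] at hs
  obtain ⟨R, hR⟩ := ContinuousLinearMap.exists_rightInverse_of_surjective (fderiv ℝ f' (φ g))
    (LinearMap.range_eq_top.2 hs)
  set e := f' (φ g) with he
  have hfe : ψ (f g) = e := by simp [he, hf', hφ]
  -- An affine complement of the kernel of the derivative, along which `f'` is invertible.
  let c : E → F := fun w => φ g + R (w - e)
  have hc : HasStrictFDerivAt c R e :=
    ((R.hasStrictFDerivAt.comp e ((hasStrictFDerivAt_id e).sub_const e))).const_add (φ g)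
  have hce : c e = φ g := by simp [c]
  have h4 : HasStrictFDerivAt (f' ∘ c)
      ((ContinuousLinearEquiv.refl ℝ E : E ≃L[ℝ] E) : E →L[ℝ] E) e := by
    have := HasStrictFDerivAt.comp e (by rw [hce]; exact h2) hc
    rwa [hR] at this
  have h5 : (f' ∘ c) e = e := by rw [Function.comp_apply, hce]
  set k := h4.localInverse with hk
  have hke : k e = e := by
    have := h4.localInverse_apply_image
    rwa [h5] at this
  have hkd : HasStrictFDerivAt k
      ((ContinuousLinearEquiv.refl ℝ E).symm : E →L[ℝ] E) e := by
    have := h4.to_localInverse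
    rw [h5] at this
    exact this
  have hkr : ∀ᶠ w in nhds e, f' (c (k w)) = w := by
    have := h4.eventually_right_inverse
    rwa [h5] at this
  have hb : MDifferentiableAt 𝓘(ℝ, E) 𝓘(ℝ, F) (fun x => φ.symm (c (k (ψ x)))) (f g) := by
    have hψd : MDifferentiableAt 𝓘(ℝ, E) 𝓘(ℝ, E) ψ (f g) :=
      mdifferentiableAt_extChartAt (ChartedSpace.mem_chart_source (f g))
    have hckd : DifferentiableAt ℝ (fun w => c (k w)) e :=
      DifferentiableAt.comp (g := c) (f := k) e
        (by rw [hke]; exact hc.hasFDerivAt.differentiableAt) hkd.hasFDerivAt.differentiableAt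
    have hφd : MDifferentiableAt 𝓘(ℝ, F) 𝓘(ℝ, F) φ.symm (φ g) := by
      have := mdifferentiableWithinAt_extChartAt_symm (I := 𝓘(ℝ, F)) (mem_extChartAt_target g)
      rwa [modelWithCornersSelf_coe, Set.range_id, mdifferentiableWithinAt_univ] at this
    have h6 : MDifferentiableAt 𝓘(ℝ, E) 𝓘(ℝ, F) (fun x => c (k (ψ x))) (f g) :=
      MDifferentiableAt.comp (f g) (g := fun w => c (k w)) (f := ψ)
        (by rw [hfe]; exact hckd.mdifferentiableAt) hψd
    exact MDifferentiableAt.comp (f g) (g := φ.symm) (f := fun x => c (k (ψ x)))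
        (by rw [hfe, hke, hce]; exact hφd) h6
  have hbg : φ.symm (c (k (ψ (f g)))) = g := by
    rw [hfe, hke, hce]
    exact extChartAt_to_inv g
  refine ⟨fun x => φ.symm (c (k (ψ x))), hbg, hb, ?_⟩
  have h7 : ∀ᶠ x in nhds (f g), x ∈ ψ.source := extChartAt_source_mem_nhds (f g)
  have h8 : ∀ᶠ x in nhds (f g), f (φ.symm (c (k (ψ x)))) ∈ ψ.source := by
    have : ContinuousAt (fun x => f (φ.symm (c (k (ψ x))))) (f g) :=
      ContinuousAt.comp (g := f) (by rw [hbg]; exact hf.continuousAt) hb.continuousAt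
    apply this.eventually_mem
    rw [hbg]
    exact extChartAt_source_mem_nhds (f g)
  have h9 : ∀ᶠ x in nhds (f g), f' (c (k (ψ x))) = ψ x := by
    have : ContinuousAt ψ (f g) := continuousAt_extChartAt (f g)
    rw [ContinuousAt, hfe] at this
    exact this.eventually hkr
  filter_upwards [h7, h8, h9] with x hx hx' hx''
  exact ψ.injOn hx' hx hx''

end Sections

/-! ### Tangent maps of the structure maps of a Lie groupoid -/

section ModelDerivatives

variable {F F' F'' : Type*} [NormedAddCommGroup F] [NormedSpace ℝ F]
  [NormedAddCommGroup F'] [NormedSpace ℝ F'] [NormedAddCommGroup F''] [NormedSpace ℝ F'']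
  {N N' N'' : Type*} [TopologicalSpace N] [ChartedSpace F N] [TopologicalSpace N']
  [ChartedSpace F' N'] [TopologicalSpace N''] [ChartedSpace F'' N'']

/-- `f` has the derivative `A` at `x`, where `A` is regarded as a map of the model spaces, so that
equalities between the base points of tangent spaces play no role. -/
def HasModelDerivAt (f : N → N') (x : N) (A : F →L[ℝ] F') : Prop :=
  HasMFDerivAt 𝓘(ℝ, F) 𝓘(ℝ, F') f x A

theorem HasModelDerivAt.comp {f : N → N'} {g : N' → N''} {x : N} {y : N'} {A : F →L[ℝ] F'}
    {B : F' →L[ℝ] F''} (hg : HasModelDerivAt g y B) (hf : HasModelDerivAt f x A) (hy : f x = y) :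
    HasModelDerivAt (fun z => g (f z)) x (B ∘L A) := by
  subst hy
  exact HasMFDerivAt.comp x hg hf

theorem HasModelDerivAt.unique {f g : N → N'} {x : N} {A B : F →L[ℝ] F'}
    (hf : HasModelDerivAt f x A) (hg : HasModelDerivAt g x B) (h : f =ᶠ[nhds x] g) : A = B :=
  hasMFDerivAt_unique hf (HasMFDerivAt.congr_of_eventuallyEq hg h)

theorem hasModelDerivAt_id (x : N) :
    HasModelDerivAt (fun z : N => z) x (ContinuousLinearMap.id ℝ F) :=
  hasMFDerivAt_id x

theorem MDifferentiableAt.exists_hasModelDerivAt {f : N → N'} {x : N}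
    (hf : MDifferentiableAt 𝓘(ℝ, F) 𝓘(ℝ, F') f x) : ∃ A : F →L[ℝ] F', HasModelDerivAt f x A :=
  ⟨mfderiv 𝓘(ℝ, F) 𝓘(ℝ, F') f x, hf.hasMFDerivAt⟩

end ModelDerivatives

namespace LieGroupoid

variable {EG : Type*} [NormedAddCommGroup EG] [NormedSpace ℝ EG]
  {G : Type*} [TopologicalSpace G] [ChartedSpace EG G]
  {E : Type*} [NormedAddCommGroup E] [NormedSpace ℝ E]
  {M : Type*} [TopologicalSpace M] [ChartedSpace E M]
  (𝒢 : LieGroupoid EG G E M)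

/-- The tangent map of the source, as a map of the model spaces. -/
noncomputable def dSrc (γ : G) : EG →L[ℝ] E := mfderiv 𝓘(ℝ, EG) 𝓘(ℝ, E) 𝒢.src γ

/-- The tangent map of the target, as a map of the model spaces. -/
noncomputable def dTgt (γ : G) : EG →L[ℝ] E := mfderiv 𝓘(ℝ, EG) 𝓘(ℝ, E) 𝒢.tgt γ

/-- The tangent map of the inversion, as a map of the model space. -/
noncomputable def dInv (γ : G) : EG →L[ℝ] EG := mfderiv 𝓘(ℝ, EG) 𝓘(ℝ, EG) 𝒢.inv γ

/-- The tangent map of the unit section, as a map of the model spaces. -/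
noncomputable def dUnit (x : M) : E →L[ℝ] EG := mfderiv 𝓘(ℝ, E) 𝓘(ℝ, EG) 𝒢.unit x

/-- The tangent map of the multiplication, as a map of the model spaces. -/
noncomputable def dMul (γ η : G) : EG × EG →L[ℝ] EG := 𝒢.tangentMul γ η

theorem hasModelDerivAt_src (γ : G) : HasModelDerivAt 𝒢.src γ (𝒢.dSrc γ) :=
  ((𝒢.smooth_src γ).mdifferentiableAt (by simp)).hasMFDerivAt

theorem hasModelDerivAt_tgt (γ : G) : HasModelDerivAt 𝒢.tgt γ (𝒢.dTgt γ) :=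
  ((𝒢.smooth_tgt γ).mdifferentiableAt (by simp)).hasMFDerivAt

theorem hasModelDerivAt_inv (γ : G) : HasModelDerivAt 𝒢.inv γ (𝒢.dInv γ) :=
  ((𝒢.smooth_inv γ).mdifferentiableAt (by simp)).hasMFDerivAt

theorem hasModelDerivAt_unit (x : M) : HasModelDerivAt 𝒢.unit x (𝒢.dUnit x) :=
  ((𝒢.smooth_unit x).mdifferentiableAt (by simp)).hasMFDerivAt

variable {𝒢} in
/-- The product rule for a family of composable pairs. -/
theorem hasModelDerivAt_mul {F N : Type*} [NormedAddCommGroup F] [NormedSpace ℝ F]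
    [TopologicalSpace N] [ChartedSpace F N] {c c' : N → G} {z : N} {γ η : G} {A A' : F →L[ℝ] EG}
    (hc : HasModelDerivAt c z A) (hc' : HasModelDerivAt c' z A') (hγ : c z = γ) (hη : c' z = η)
    (h : ∀ᶠ y in nhds z, 𝒢.src (c y) = 𝒢.tgt (c' y)) :
    HasModelDerivAt (fun y => 𝒢.mul (c y) (c' y)) z (𝒢.dMul γ η ∘L A.prod A') := by
  subst hγ hη
  have h1 : MDifferentiableWithinAt (𝓘(ℝ, EG).prod 𝓘(ℝ, EG)) 𝓘(ℝ, EG)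
      (fun p : G × G => 𝒢.mul p.1 p.2) 𝒢.composable (c z, c' z) :=
    (𝒢.smooth_mul (c z, c' z) h.self_of_nhds).mdifferentiableWithinAt (by simp)
  have h2 : HasMFDerivAt 𝓘(ℝ, F) (𝓘(ℝ, EG).prod 𝓘(ℝ, EG)) (fun y => (c y, c' y)) z
      (A.prod A') := HasMFDerivAt.prodMk hc hc'
  have hs : {y | 𝒢.src (c y) = 𝒢.tgt (c' y)} ⊆ (fun y => (c y, c' y)) ⁻¹' 𝒢.composable :=
    fun y hy => hy
  have h3 := HasMFDerivWithinAt.comp z h1.hasMFDerivWithinAt h2.hasMFDerivWithinAt hs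
  exact h3.hasMFDerivAt h

theorem inv_inv (γ : G) : 𝒢.inv (𝒢.inv γ) = γ := by
  have h1 := 𝒢.mul_assoc (𝒢.inv (𝒢.inv γ)) (𝒢.inv γ) γ (by rw [src_inv]) (by rw [src_inv])
  rw [𝒢.inv_mul, 𝒢.inv_mul, 𝒢.src_inv, 𝒢.unit_mul, ← 𝒢.tgt_inv γ, ← 𝒢.src_inv (𝒢.inv γ),
    𝒢.mul_unit] at h1
  exact h1.symm

theorem dSrc_dInv (γ : G) (X : EG) : 𝒢.dSrc (𝒢.inv γ) (𝒢.dInv γ X) = 𝒢.dTgt γ X :=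
  DFunLike.congr_fun (((𝒢.hasModelDerivAt_src _).comp (𝒢.hasModelDerivAt_inv γ) rfl).unique
    (𝒢.hasModelDerivAt_tgt γ) (.of_forall 𝒢.src_inv)) X

theorem dTgt_dInv (γ : G) (X : EG) : 𝒢.dTgt (𝒢.inv γ) (𝒢.dInv γ X) = 𝒢.dSrc γ X :=
  DFunLike.congr_fun (((𝒢.hasModelDerivAt_tgt _).comp (𝒢.hasModelDerivAt_inv γ) rfl).unique
    (𝒢.hasModelDerivAt_src γ) (.of_forall 𝒢.tgt_inv)) X

theorem dInv_dInv (γ : G) (X : EG) : 𝒢.dInv (𝒢.inv γ) (𝒢.dInv γ X) = X :=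
  DFunLike.congr_fun (((𝒢.hasModelDerivAt_inv _).comp (𝒢.hasModelDerivAt_inv γ) rfl).unique
    (hasModelDerivAt_id γ) (.of_forall 𝒢.inv_inv)) X

theorem dInv_dInv' (γ : G) (X : EG) : 𝒢.dInv γ (𝒢.dInv (𝒢.inv γ) X) = X := by
  have h := 𝒢.dInv_dInv (𝒢.inv γ) X
  rwa [inv_inv] at h

theorem dSrc_dUnit (x : M) (v : E) : 𝒢.dSrc (𝒢.unit x) (𝒢.dUnit x v) = v :=
  DFunLike.congr_fun (((𝒢.hasModelDerivAt_src _).comp (𝒢.hasModelDerivAt_unit x) rfl).unique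
    (hasModelDerivAt_id x) (.of_forall 𝒢.src_unit)) v

theorem dTgt_dUnit (x : M) (v : E) : 𝒢.dTgt (𝒢.unit x) (𝒢.dUnit x v) = v :=
  DFunLike.congr_fun (((𝒢.hasModelDerivAt_tgt _).comp (𝒢.hasModelDerivAt_unit x) rfl).unique
    (hasModelDerivAt_id x) (.of_forall 𝒢.tgt_unit)) v

theorem dMul_dUnit_dUnit (x : M) (v : E) :
    𝒢.dMul (𝒢.unit x) (𝒢.unit x) (𝒢.dUnit x v, 𝒢.dUnit x v) = 𝒢.dUnit x v :=
  DFunLike.congr_fun ((hasModelDerivAt_mul (𝒢.hasModelDerivAt_unit x) (𝒢.hasModelDerivAt_unit x)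
    rfl rfl (.of_forall fun y => by rw [src_unit, tgt_unit])).unique (𝒢.hasModelDerivAt_unit x)
      (.of_forall fun y => by
        have := 𝒢.unit_mul (𝒢.unit y)
        rwa [tgt_unit] at this)) v

theorem dMul_dInv (γ : G) (X : EG) :
    𝒢.dMul γ (𝒢.inv γ) (X, 𝒢.dInv γ X) = 𝒢.dUnit (𝒢.tgt γ) (𝒢.dTgt γ X) :=
  DFunLike.congr_fun ((hasModelDerivAt_mul (hasModelDerivAt_id γ) (𝒢.hasModelDerivAt_inv γ)
    rfl rfl (.of_forall fun y => by rw [tgt_inv])).unique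
      ((𝒢.hasModelDerivAt_unit _).comp (𝒢.hasModelDerivAt_tgt γ) rfl)
      (.of_forall 𝒢.mul_inv)) X

theorem dMul_zero_of_unit {γ : G} {X : EG} (hX : 𝒢.dSrc γ X = 0) :
    𝒢.dMul γ (𝒢.unit (𝒢.src γ)) (X, 0) = X := by
  have h := DFunLike.congr_fun ((hasModelDerivAt_mul (hasModelDerivAt_id γ)
    ((𝒢.hasModelDerivAt_unit _).comp (𝒢.hasModelDerivAt_src γ) rfl)
    rfl rfl (.of_forall fun y => by rw [tgt_unit])).unique (hasModelDerivAt_id γ)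
      (.of_forall 𝒢.mul_unit)) X
  simpa [hX] using h

section Translation

variable [FiniteDimensional ℝ E] [IsManifold 𝓘(ℝ, EG) ∞ G] [IsManifold 𝓘(ℝ, E) ∞ M]

theorem exists_section_src (γ : G) : ∃ (b : M → G) (B : E →L[ℝ] EG), b (𝒢.src γ) = γ ∧
    HasModelDerivAt b (𝒢.src γ) B ∧ ∀ᶠ x in nhds (𝒢.src γ), 𝒢.src (b x) = x := by
  obtain ⟨b, h1, h2, h3⟩ := exists_local_section (𝒢.smooth_src γ) (𝒢.submersion_src γ)
  obtain ⟨B, hB⟩ := h2.exists_hasModelDerivAt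
  exact ⟨b, B, h1, hB, h3⟩

theorem exists_section_tgt (γ : G) : ∃ (b : M → G) (B : E →L[ℝ] EG), b (𝒢.tgt γ) = γ ∧
    HasModelDerivAt b (𝒢.tgt γ) B ∧ ∀ᶠ x in nhds (𝒢.tgt γ), 𝒢.tgt (b x) = x := by
  obtain ⟨b, h1, h2, h3⟩ := exists_local_section (𝒢.smooth_tgt γ) (𝒢.submersion_tgt γ)
  obtain ⟨B, hB⟩ := h2.exists_hasModelDerivAt
  exact ⟨b, B, h1, hB, h3⟩

variable {𝒢} {γ η : G}

/-- Right translation of a vector `X` tangent to the fibres of the source. A local section of the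
target through `η` extends `ζ ↦ ζ η` from a source fibre to a neighbourhood of `γ`. -/
theorem dTgt_dMul_zero_right (h : 𝒢.src γ = 𝒢.tgt η) {X : EG}
    (hX : 𝒢.dSrc γ X = 0) :
    𝒢.dTgt (𝒢.mul γ η) (𝒢.dMul γ η (X, 0)) = 𝒢.dTgt γ X ∧
      𝒢.dSrc (𝒢.mul γ η) (𝒢.dMul γ η (X, 0)) = 0 := by
  obtain ⟨b, B, h1, h2, h3⟩ := 𝒢.exists_section_tgt η
  rw [← h] at h1 h2 h3
  have h4 : ∀ᶠ ζ in nhds γ, 𝒢.src ζ = 𝒢.tgt (b (𝒢.src ζ)) :=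
    ((𝒢.smooth_src γ).continuousAt.eventually h3).mono fun ζ hζ => hζ.symm
  have h5 := h2.comp (𝒢.hasModelDerivAt_src γ) rfl
  have h6 := hasModelDerivAt_mul (hasModelDerivAt_id γ) h5 rfl h1 h4
  have h7 : 𝒢.mul γ (b (𝒢.src γ)) = 𝒢.mul γ η := by rw [h1]
  have h8 := DFunLike.congr_fun (((𝒢.hasModelDerivAt_tgt _).comp h6 h7).unique
    (𝒢.hasModelDerivAt_tgt γ) (h4.mono fun ζ hζ => 𝒢.tgt_mul _ _ hζ)) X
  have h9 := DFunLike.congr_fun (((𝒢.hasModelDerivAt_src _).comp h6 h7).unique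
    ((𝒢.hasModelDerivAt_src η).comp h5 h1) (h4.mono fun ζ hζ => 𝒢.src_mul _ _ hζ)) X
  simp only [ContinuousLinearMap.comp_apply, ContinuousLinearMap.prod_apply,
    ContinuousLinearMap.id_apply, hX, map_zero] at h8 h9
  exact ⟨h8, h9⟩

/-- Left translation of a vector `Y` tangent to the fibres of the target. -/
theorem dSrc_dMul_zero_left (h : 𝒢.src γ = 𝒢.tgt η) {Y : EG} (hY : 𝒢.dTgt η Y = 0) :
    𝒢.dSrc (𝒢.mul γ η) (𝒢.dMul γ η (0, Y)) = 𝒢.dSrc η Y ∧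
      𝒢.dTgt (𝒢.mul γ η) (𝒢.dMul γ η (0, Y)) = 0 := by
  obtain ⟨b, B, h1, h2, h3⟩ := 𝒢.exists_section_src γ
  rw [h] at h1 h2 h3
  have h4 : ∀ᶠ ζ in nhds η, 𝒢.src (b (𝒢.tgt ζ)) = 𝒢.tgt ζ :=
    (𝒢.smooth_tgt η).continuousAt.eventually h3
  have h5 := h2.comp (𝒢.hasModelDerivAt_tgt η) rfl
  have h6 := hasModelDerivAt_mul h5 (hasModelDerivAt_id η) h1 rfl h4
  have h7 : 𝒢.mul (b (𝒢.tgt η)) η = 𝒢.mul γ η := by rw [h1]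
  have h8 := DFunLike.congr_fun (((𝒢.hasModelDerivAt_src _).comp h6 h7).unique
    (𝒢.hasModelDerivAt_src η) (h4.mono fun ζ hζ => 𝒢.src_mul _ _ hζ)) Y
  have h9 := DFunLike.congr_fun (((𝒢.hasModelDerivAt_tgt _).comp h6 h7).unique
    ((𝒢.hasModelDerivAt_tgt γ).comp h5 h1) (h4.mono fun ζ hζ => 𝒢.tgt_mul _ _ hζ)) Y
  simp only [ContinuousLinearMap.comp_apply, ContinuousLinearMap.prod_apply,
    ContinuousLinearMap.id_apply, hY, map_zero] at h8 h9
  exact ⟨h8, h9⟩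

/-- Right translation is onto the vectors tangent to the source fibres: the inverse translation
`ζ ↦ ζ η⁻¹` is extended with a local section of the source through `η`. -/
theorem exists_dMul_zero_right (h : 𝒢.src γ = 𝒢.tgt η) {Z : EG}
    (hZ : 𝒢.dSrc (𝒢.mul γ η) Z = 0) :
    ∃ X, 𝒢.dSrc γ X = 0 ∧ 𝒢.dTgt γ X = 𝒢.dTgt (𝒢.mul γ η) Z ∧ 𝒢.dMul γ η (X, 0) = Z := by
  obtain ⟨b, B, h1, h2, h3⟩ := 𝒢.exists_section_src η
  rw [← 𝒢.src_mul γ η h] at h1 h2 h3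
  set ζ₀ := 𝒢.mul γ η with hζ₀
  have h4 : ∀ᶠ ζ in nhds ζ₀, 𝒢.src (b (𝒢.src ζ)) = 𝒢.src ζ :=
    (𝒢.smooth_src ζ₀).continuousAt.eventually h3
  have h5 := h2.comp (𝒢.hasModelDerivAt_src ζ₀) rfl
  have h6 := (𝒢.hasModelDerivAt_inv η).comp h5 h1
  have h7 : ∀ᶠ ζ in nhds ζ₀, 𝒢.src ζ = 𝒢.tgt (𝒢.inv (b (𝒢.src ζ))) :=
    h4.mono fun ζ hζ => by rw [tgt_inv, hζ]
  have h8 := hasModelDerivAt_mul (hasModelDerivAt_id ζ₀) h6 rfl (by rw [h1]) h7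
  have h9 : 𝒢.mul ζ₀ (𝒢.inv (b (𝒢.src ζ₀))) = γ := by
    rw [h1, hζ₀, 𝒢.mul_assoc _ _ _ h (by rw [tgt_inv]), mul_inv, ← h, mul_unit]
  have h10 : ∀ᶠ ζ in nhds ζ₀, 𝒢.src (𝒢.mul ζ (𝒢.inv (b (𝒢.src ζ)))) = 𝒢.tgt (b (𝒢.src ζ)) :=
    h7.mono fun ζ hζ => by rw [𝒢.src_mul _ _ hζ, src_inv]
  have h11 := DFunLike.congr_fun (((𝒢.hasModelDerivAt_src γ).comp h8 h9).unique
    ((𝒢.hasModelDerivAt_tgt η).comp h5 h1) h10) Z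
  have h12 := DFunLike.congr_fun (((𝒢.hasModelDerivAt_tgt γ).comp h8 h9).unique
    (𝒢.hasModelDerivAt_tgt ζ₀) (h7.mono fun ζ hζ => 𝒢.tgt_mul _ _ hζ)) Z
  have h13 := DFunLike.congr_fun ((hasModelDerivAt_mul h8 h5 h9 h1 h10).unique
    (hasModelDerivAt_id ζ₀) ((h4.and h7).mono fun ζ hζ => by
      change 𝒢.mul (𝒢.mul ζ _) _ = ζ
      rw [𝒢.mul_assoc _ _ _ hζ.2 (by rw [src_inv]), inv_mul, hζ.1, mul_unit])) Z
  simp only [ContinuousLinearMap.comp_apply, ContinuousLinearMap.prod_apply,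
    ContinuousLinearMap.id_apply, hZ, map_zero] at h11 h12 h13
  exact ⟨_, h11, h12, h13⟩

/-- Left translation is onto the vectors tangent to the target fibres. -/
theorem exists_dMul_zero_left (h : 𝒢.src γ = 𝒢.tgt η) {Z : EG}
    (hZ : 𝒢.dTgt (𝒢.mul γ η) Z = 0) :
    ∃ Y, 𝒢.dTgt η Y = 0 ∧ 𝒢.dSrc η Y = 𝒢.dSrc (𝒢.mul γ η) Z ∧ 𝒢.dMul γ η (0, Y) = Z := by
  obtain ⟨b, B, h1, h2, h3⟩ := 𝒢.exists_section_tgt γ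
  rw [← 𝒢.tgt_mul γ η h] at h1 h2 h3
  set ζ₀ := 𝒢.mul γ η with hζ₀
  have h4 : ∀ᶠ ζ in nhds ζ₀, 𝒢.tgt (b (𝒢.tgt ζ)) = 𝒢.tgt ζ :=
    (𝒢.smooth_tgt ζ₀).continuousAt.eventually h3
  have h5 := h2.comp (𝒢.hasModelDerivAt_tgt ζ₀) rfl
  have h6 := (𝒢.hasModelDerivAt_inv γ).comp h5 h1
  have h7 : ∀ᶠ ζ in nhds ζ₀, 𝒢.src (𝒢.inv (b (𝒢.tgt ζ))) = 𝒢.tgt ζ :=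
    h4.mono fun ζ hζ => by rw [src_inv, hζ]
  have h8 := hasModelDerivAt_mul h6 (hasModelDerivAt_id ζ₀) (by rw [h1]) rfl h7
  have h9 : 𝒢.mul (𝒢.inv (b (𝒢.tgt ζ₀))) ζ₀ = η := by
    rw [h1, hζ₀, ← 𝒢.mul_assoc _ _ _ (by rw [src_inv]) h, inv_mul, h, unit_mul]
  have h10 : ∀ᶠ ζ in nhds ζ₀, 𝒢.src (b (𝒢.tgt ζ)) = 𝒢.tgt (𝒢.mul (𝒢.inv (b (𝒢.tgt ζ))) ζ) :=
    h7.mono fun ζ hζ => by rw [𝒢.tgt_mul _ _ hζ, tgt_inv]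
  have h11 := DFunLike.congr_fun (((𝒢.hasModelDerivAt_tgt η).comp h8 h9).unique
    ((𝒢.hasModelDerivAt_src γ).comp h5 h1) (h10.mono fun ζ hζ => hζ.symm)) Z
  have h12 := DFunLike.congr_fun (((𝒢.hasModelDerivAt_src η).comp h8 h9).unique
    (𝒢.hasModelDerivAt_src ζ₀) (h7.mono fun ζ hζ => 𝒢.src_mul _ _ hζ)) Z
  have h13 := DFunLike.congr_fun ((hasModelDerivAt_mul h5 h8 h1 h9 h10).unique
    (hasModelDerivAt_id ζ₀) ((h4.and h7).mono fun ζ hζ => by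
      change 𝒢.mul _ (𝒢.mul _ ζ) = ζ
      rw [← 𝒢.mul_assoc _ _ _ (by rw [tgt_inv]) hζ.2, mul_inv, hζ.1, unit_mul])) Z
  simp only [ContinuousLinearMap.comp_apply, ContinuousLinearMap.prod_apply,
    ContinuousLinearMap.id_apply, hZ, map_zero] at h11 h12 h13
  exact ⟨_, h11, h12, h13⟩

end Translation

end LieGroupoid

/-! ### The symplectic form of a symplectic groupoid -/

namespace SymplecticGroupoid

variable {EG : Type*} [NormedAddCommGroup EG] [NormedSpace ℝ EG]
  {G : Type*} [TopologicalSpace G] [ChartedSpace EG G] [IsManifold 𝓘(ℝ, EG) ∞ G]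
  {E : Type*} [NormedAddCommGroup E] [NormedSpace ℝ E]
  {M : Type*} [TopologicalSpace M] [ChartedSpace E M]
  (S : SymplecticGroupoid EG G E M)

/-- The symplectic form at `γ`, as a bilinear form on the model space. -/
def formAt (γ : G) : LinearMap.BilinForm ℝ EG := S.form.form γ

theorem isAlt_formAt (γ : G) : (S.formAt γ).IsAlt := S.form.alternating γ

theorem formAt_nondegenerate (γ : G) (X : EG) (hX : ∀ Y, S.formAt γ X Y = 0) : X = 0 :=
  S.form.nondegenerate γ X hX

theorem formAt_dMul {γ η : G} (h : S.src γ = S.tgt η) {X X' Y Y' : EG}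
    (hXY : S.dSrc γ X = S.dTgt η Y) (hXY' : S.dSrc γ X' = S.dTgt η Y') :
    S.formAt (S.mul γ η) (S.dMul γ η (X, Y)) (S.dMul γ η (X', Y')) =
      S.formAt γ X X' + S.formAt η Y Y' := by
  have h1 : ∀ (x y : M) (v w : E), x = y → v = w →
      (⟨x, v⟩ : TangentBundle 𝓘(ℝ, E) M) = ⟨y, w⟩ := by
    rintro x _ v _ rfl rfl
    rfl
  exact S.multiplicative γ η h X X' Y Y' (h1 _ _ _ _ h hXY) (h1 _ _ _ _ h hXY')

/-- The unit section is isotropic, because `x = x · x` for a unit `x`. -/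
theorem formAt_dUnit (x : M) (v w : E) :
    S.formAt (S.unit x) (S.dUnit x v) (S.dUnit x w) = 0 := by
  have h1 := S.formAt_dMul (γ := S.unit x) (η := S.unit x) (X := S.dUnit x v) (Y := S.dUnit x v)
    (X' := S.dUnit x w) (Y' := S.dUnit x w) (by rw [S.src_unit, S.tgt_unit])
    (by rw [S.dSrc_dUnit, S.dTgt_dUnit]) (by rw [S.dSrc_dUnit, S.dTgt_dUnit])
  have h2 : S.mul (S.unit x) (S.unit x) = S.unit x := by
    have := S.unit_mul (S.unit x)
    rwa [S.tgt_unit] at this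
  rw [S.dMul_dUnit_dUnit, S.dMul_dUnit_dUnit, h2] at h1
  linarith

/-- The inversion is antisymplectic, because its graph is mapped by the multiplication to the
isotropic unit section. -/
theorem formAt_dInv (γ : G) (X X' : EG) :
    S.formAt (S.inv γ) (S.dInv γ X) (S.dInv γ X') = -S.formAt γ X X' := by
  have h1 := S.formAt_dMul (γ := γ) (η := S.inv γ) (X := X) (Y := S.dInv γ X)
    (X' := X') (Y' := S.dInv γ X') (by rw [S.tgt_inv])
    (by rw [S.dTgt_dInv]) (by rw [S.dTgt_dInv])
  rw [S.dMul_dInv, S.dMul_dInv, S.mul_inv, S.formAt_dUnit] at h1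
  linarith

/-- The source and target fibres are symplectically orthogonal: `X = X · 0` and `Y = 0 · Y'` as
products over `γ = γ · 1`. -/
theorem formAt_ker_src_ker_tgt [FiniteDimensional ℝ E] [IsManifold 𝓘(ℝ, E) ∞ M] {γ : G}
    {X Y : EG} (hX : S.dSrc γ X = 0) (hY : S.dTgt γ Y = 0) : S.formAt γ X Y = 0 := by
  have h1 : S.src γ = S.tgt (S.unit (S.src γ)) := by rw [S.tgt_unit]
  have h2 := S.mul_unit γ
  obtain ⟨Y', h3, -, h4⟩ := LieGroupoid.exists_dMul_zero_left h1 (Z := Y) (by rwa [h2])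
  have h5 := S.formAt_dMul h1 (X := X) (Y := 0) (X' := 0) (Y' := Y')
    (by rw [hX, map_zero]) (by rw [h3, map_zero])
  rw [S.dMul_zero_of_unit hX, h4, h2] at h5
  simpa using h5

theorem finrank_eq_two_mul_finrank [FiniteDimensional ℝ EG] [FiniteDimensional ℝ E]
    [IsManifold 𝓘(ℝ, E) ∞ M] (S : SymplecticGroupoid EG G E M) (x : M) :
    Module.finrank ℝ EG = 2 * Module.finrank ℝ E :=
  finrank_eq_two_mul (S.isAlt_formAt (S.unit x)) (S.formAt_nondegenerate (S.unit x))
    (t := (S.dTgt (S.unit x)).toLinearMap) (s := (S.dSrc (S.unit x)).toLinearMap)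
    (u := (S.dUnit x).toLinearMap) (S.dTgt_dUnit x) (S.dSrc_dUnit x) (S.formAt_dUnit x)
    fun _ _ hX hY => S.formAt_ker_src_ker_tgt hX hY

/-- The orthogonal of the tangent space of a target fibre is that of a source fibre. -/
theorem dSrc_eq_zero [FiniteDimensional ℝ EG] [FiniteDimensional ℝ E]
    [IsManifold 𝓘(ℝ, E) ∞ M] {γ : G} {X : EG}
    (hX : ∀ Y, S.dTgt γ Y = 0 → S.formAt γ X Y = 0) : S.dSrc γ X = 0 :=
  apply_eq_zero_of_forall_ker (S.isAlt_formAt γ) (S.formAt_nondegenerate γ)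
    (t := (S.dTgt γ).toLinearMap) (s := (S.dSrc γ).toLinearMap)
    (S.submersion_tgt γ) (S.submersion_src γ) (S.finrank_eq_two_mul_finrank (S.src γ))
    (fun _ _ hX hY => S.formAt_ker_src_ker_tgt hX hY) hX

/-- The orthogonal of the tangent space of a source fibre is that of a target fibre. -/
theorem dTgt_eq_zero [FiniteDimensional ℝ EG] [FiniteDimensional ℝ E]
    [IsManifold 𝓘(ℝ, E) ∞ M] {γ : G} {X : EG}
    (hX : ∀ Y, S.dSrc γ Y = 0 → S.formAt γ X Y = 0) : S.dTgt γ X = 0 :=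
  apply_eq_zero_of_forall_ker (S.isAlt_formAt γ) (S.formAt_nondegenerate γ)
    (t := (S.dSrc γ).toLinearMap) (s := (S.dTgt γ).toLinearMap)
    (S.submersion_src γ) (S.submersion_tgt γ) (S.finrank_eq_two_mul_finrank (S.src γ))
    (fun _ _ hX hY => (S.isAlt_formAt γ).isRefl _ _ (S.formAt_ker_src_ker_tgt hY hX)) hX

end SymplecticGroupoid

/-! ### Kähler–Poisson structures -/

section KaehlerPoisson

variable {E : Type*} [NormedAddCommGroup E] [NormedSpace ℂ E]
  {M : Type*} [TopologicalSpace M] [ChartedSpace E M]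

theorem hasModelDerivAt_comp_extChartAt [IsManifold 𝓘(ℂ, E) ω M] (x : M) (α : E →L[ℝ] ℝ) :
    HasModelDerivAt (fun y => α (extChartAt 𝓘(ℝ, E) x y)) x α := by
  have h1 : HasModelDerivAt (extChartAt 𝓘(ℝ, E) x) x (ContinuousLinearMap.id ℝ E) := by
    have h := (mdifferentiableAt_extChartAt (I := 𝓘(ℝ, E)) (x := x)
      (ChartedSpace.mem_chart_source x)).hasMFDerivAt
    rw [mfderiv_extChartAt_self] at h
    exact h
  have h2 : HasModelDerivAt α (extChartAt 𝓘(ℝ, E) x x) α := α.hasMFDerivAt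
  exact h2.comp h1 rfl

/-- The Poisson bivector at `x`, as a bilinear form on the dual of the model space. -/
def PoissonStructure.bivectorAt (π : PoissonStructure E M) (x : M) :
    LinearMap.BilinForm ℝ (E →L[ℝ] ℝ) := π.bivector x

/-- A Kähler–Poisson bivector vanishes on pairs of covectors of type `(1,0)`, since these are the
differentials of holomorphic functions: complex linear functionals of a holomorphic chart. -/
theorem PoissonStructure.IsKaehlerPoisson.bivector_eq [IsManifold 𝓘(ℂ, E) ω M]
    {π : PoissonStructure E M} (hπ : π.IsKaehlerPoisson) (x : M) (α β : E →L[ℂ] ℂ) :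
    π.bivectorAt x (Complex.reCLM ∘L α.restrictScalars ℝ) (Complex.reCLM ∘L β.restrictScalars ℝ) =
      π.bivectorAt x (Complex.imCLM ∘L α.restrictScalars ℝ)
        (Complex.imCLM ∘L β.restrictScalars ℝ) ∧
    π.bivectorAt x (Complex.reCLM ∘L α.restrictScalars ℝ) (Complex.imCLM ∘L β.restrictScalars ℝ) =
      -π.bivectorAt x (Complex.imCLM ∘L α.restrictScalars ℝ)
        (Complex.reCLM ∘L β.restrictScalars ℝ) := by
  have : IsManifold 𝓘(ℂ, E) 1 M := .of_le (n := ω) le_top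
  have h1 : ∀ α : E →L[ℂ] ℂ, MDifferentiableOn 𝓘(ℂ, E) 𝓘(ℂ, ℂ)
      (fun y => α (extChartAt 𝓘(ℂ, E) x y)) (chartAt E x).source := fun α y hy =>
    (α.mdifferentiableAt.comp y (mdifferentiableAt_extChartAt hy)).mdifferentiableWithinAt
  have h2 : ∀ α : E →L[ℝ] ℝ,
      mvfderiv 𝓘(ℝ, E) (fun y => α (extChartAt 𝓘(ℝ, E) x y)) x = α := fun α =>
    HasMFDerivAt.mfderiv (hasModelDerivAt_comp_extChartAt x α)
  have h3 := hπ _ (chartAt E x).open_source _ _ (h1 α) (h1 β) x (ChartedSpace.mem_chart_source x)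
  have h4 : ∀ α β : E →L[ℝ] ℝ, π.bracket (fun y => α (extChartAt 𝓘(ℝ, E) x y))
      (fun y => β (extChartAt 𝓘(ℝ, E) x y)) x = π.bivectorAt x α β := fun α β => by
    rw [PoissonStructure.bracket, h2, h2]
    rfl
  have h5 := h4 (Complex.reCLM ∘L α.restrictScalars ℝ) (Complex.reCLM ∘L β.restrictScalars ℝ)
  have h6 := h4 (Complex.imCLM ∘L α.restrictScalars ℝ) (Complex.imCLM ∘L β.restrictScalars ℝ)
  have h7 := h4 (Complex.reCLM ∘L α.restrictScalars ℝ) (Complex.imCLM ∘L β.restrictScalars ℝ)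
  have h8 := h4 (Complex.imCLM ∘L α.restrictScalars ℝ) (Complex.reCLM ∘L β.restrictScalars ℝ)
  rw [← h5, ← h6, ← h7, ← h8, ← sub_eq_zero, ← add_eq_zero_iff_eq_neg]
  have h9 : ∀ a b : ℝ, (a : ℂ) + Complex.I * (b : ℂ) = 0 → a = 0 ∧ b = 0 := fun a b hab => by
    simpa [Complex.ext_iff] using hab
  exact h9 _ _ h3

/-- Holomorphic charts have complex linear derivatives, at every point of their domain. -/
theorem exists_hasModelDerivAt_extChartAt [IsManifold 𝓘(ℂ, E) ω M] (z : M) {y : M}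
    (hy : y ∈ (chartAt E z).source) :
    ∃ A : E ≃L[ℂ] E, HasModelDerivAt (extChartAt 𝓘(ℝ, E) z) y
      ((A : E →L[ℂ] E).restrictScalars ℝ) := by
  have : IsManifold 𝓘(ℂ, E) 1 M := .of_le (n := ω) le_top
  have h1 := (mdifferentiableAt_extChartAt (I := 𝓘(ℂ, E)) hy).hasMFDerivAt
  obtain ⟨A, hA⟩ := isInvertible_mfderiv_extChartAt (I := 𝓘(ℂ, E)) (x := z) (y := y)
    (by rwa [extChartAt_source])
  rw [← hA] at h1
  exact ⟨A, h1.1, HasFDerivWithinAt.restrictScalars ℝ h1.2⟩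

variable [IsManifold 𝓘(ℂ, E) ω M]
  {EG : Type*} [NormedAddCommGroup EG] [NormedSpace ℝ EG]
  {G : Type*} [TopologicalSpace G] [ChartedSpace EG G] [IsManifold 𝓘(ℝ, EG) ∞ G]
  {π : PoissonStructure E M} {S : SymplecticGroupoid EG G E M}

theorem pullbackInvolution_dTgt (hπ : π.IsKaehlerPoisson) (hS : S.Integrates π) (γ : G) :
    PullbackInvolution (S.formAt γ) (S.dTgt γ).toLinearMap := by
  intro α β X X' Y Y' hX hX' hY hY'
  have h := hS.isPoissonMap_tgt γ
  have h1 := hπ.bivector_eq (S.tgt γ) α β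
  have h2 : S.formAt γ X Y = π.bivectorAt (S.tgt γ) (Complex.reCLM ∘L α.restrictScalars ℝ)
    (Complex.reCLM ∘L β.restrictScalars ℝ) := h _ _ X Y hX hY
  have h3 : S.formAt γ X' Y' = π.bivectorAt (S.tgt γ) (Complex.imCLM ∘L α.restrictScalars ℝ)
    (Complex.imCLM ∘L β.restrictScalars ℝ) := h _ _ X' Y' hX' hY'
  have h4 : S.formAt γ X Y' = π.bivectorAt (S.tgt γ) (Complex.reCLM ∘L α.restrictScalars ℝ)
    (Complex.imCLM ∘L β.restrictScalars ℝ) := h _ _ X Y' hX hY'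
  have h5 : S.formAt γ X' Y = π.bivectorAt (S.tgt γ) (Complex.imCLM ∘L α.restrictScalars ℝ)
    (Complex.reCLM ∘L β.restrictScalars ℝ) := h _ _ X' Y hX' hY
  rw [h2, h3, h4, h5]
  exact h1

/-- The source inherits the property of the target through the antisymplectic inversion. -/
theorem pullbackInvolution_dSrc (hπ : π.IsKaehlerPoisson) (hS : S.Integrates π) (γ : G) :
    PullbackInvolution (S.formAt γ) (S.dSrc γ).toLinearMap := by
  intro α β X X' Y Y' hX hX' hY hY'
  have h1 : ∀ X Z, S.formAt (S.inv γ) (S.dInv γ X) Z =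
      -S.formAt γ X (S.dInv (S.inv γ) Z) := fun X Z => by
    rw [← S.formAt_dInv, S.dInv_dInv']
  have h2 : ∀ Z, S.dSrc γ (S.dInv (S.inv γ) Z) = S.dTgt (S.inv γ) Z := fun Z => by
    rw [← S.dTgt_dInv, S.dInv_dInv']
  have h3 := pullbackInvolution_dTgt hπ hS (S.inv γ) (-α) (-β) (S.dInv γ X) (S.dInv γ X')
    (S.dInv γ Y) (S.dInv γ Y')
    (fun Z => by rw [h1, hX]; simp [h2]) (fun Z => by rw [h1, hX']; simp [h2])
    (fun Z => by rw [h1, hY]; simp [h2]) (fun Z => by rw [h1, hY']; simp [h2])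
  simp only [S.formAt_dInv, neg_inj] at h3
  exact h3

end KaehlerPoisson

/-! ### The polarization -/

section Involutive

variable {E : Type*} [NormedAddCommGroup E] [NormedSpace ℂ E]
  {M : Type*} [TopologicalSpace M] [ChartedSpace E M] [IsManifold 𝓘(ℂ, E) ω M]
  {EG : Type*} [NormedAddCommGroup EG] [NormedSpace ℝ EG] [CompleteSpace EG]
  {G : Type*} [TopologicalSpace G] [ChartedSpace EG G] [IsManifold 𝓘(ℝ, EG) ∞ G]

/-- The complex vector fields that a map `f` to a complex manifold takes to the eigenspaces of `J`
for one of the eigenvalues `∓i` are closed under the Lie bracket. In a holomorphic chart, `J` is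
constant. -/
theorem smul_apply_complex_mlieBracket {f : G → M} (hf : ContMDiff 𝓘(ℝ, EG) 𝓘(ℝ, E) ∞ f)
    {f' : G → EG →L[ℝ] E} (hf' : ∀ γ, HasModelDerivAt f γ (f' γ)) {c : ℂ} (hc : c * c = -1)
    {U : Set G} (hU : IsOpen U) {X₁ X₂ Y₁ Y₂ : ∀ γ : G, TangentSpace 𝓘(ℝ, EG) γ}
    (hX₁ : IsSmoothField U X₁) (hX₂ : IsSmoothField U X₂) (hY₁ : IsSmoothField U Y₁)
    (hY₂ : IsSmoothField U Y₂) (hX : ∀ γ ∈ U, f' γ (X₂ γ) = c • f' γ (X₁ γ))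
    (hY : ∀ γ ∈ U, f' γ (Y₂ γ) = c • f' γ (Y₁ γ)) {γ : G} (hγ : γ ∈ U) :
    f' γ (mlieBracket 𝓘(ℝ, EG) X₁ Y₂ γ + mlieBracket 𝓘(ℝ, EG) X₂ Y₁ γ) =
      c • f' γ (mlieBracket 𝓘(ℝ, EG) X₁ Y₁ γ - mlieBracket 𝓘(ℝ, EG) X₂ Y₂ γ) := by
  have hsm : ∀ {X : ∀ γ : G, TangentSpace 𝓘(ℝ, EG) γ}, IsSmoothField U X →
      MDifferentiableAt 𝓘(ℝ, EG) 𝓘(ℝ, EG).tangent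
        (fun γ => (⟨γ, X γ⟩ : TangentBundle 𝓘(ℝ, EG) G)) γ := fun hX =>
    (hX.contMDiffAt (hU.mem_nhds hγ)).mdifferentiableAt (by simp)
  let J : E →L[ℝ] E := (c • ContinuousLinearMap.id ℂ E).restrictScalars ℝ
  have hJ : ∀ v, J (J v) = -v := fun v => by
    change c • c • v = -v
    rw [smul_smul, hc, neg_one_smul]
  let Φ : G → E := fun ζ => extChartAt 𝓘(ℝ, E) (f γ) (f ζ)
  have hΦ : ContMDiffAt 𝓘(ℝ, EG) 𝓘(ℝ, E) 2 Φ γ :=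
    (contMDiffAt_extChartAt.comp γ (hf γ)).of_le ENat.LEInfty.out
  have hΦ' : ∀ ζ, f ζ ∈ (chartAt E (f γ)).source → ∃ A : E ≃L[ℂ] E, ∀ v : EG,
      mvfderiv 𝓘(ℝ, EG) Φ ζ v = A (f' ζ v) := fun ζ hζ => by
    obtain ⟨A, hA⟩ := exists_hasModelDerivAt_extChartAt (f γ) hζ
    refine ⟨A, fun v => ?_⟩
    exact DFunLike.congr_fun (HasMFDerivAt.mfderiv (hA.comp (hf' ζ) rfl)) v
  have hnhds : ∀ᶠ ζ in nhds γ, f ζ ∈ (chartAt E (f γ)).source :=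
    (hf γ).continuousAt.eventually_mem
      ((chartAt E (f γ)).open_source.mem_nhds (ChartedSpace.mem_chart_source _))
  have hZ : ∀ {Z₁ Z₂ : ∀ γ : G, TangentSpace 𝓘(ℝ, EG) γ},
      (∀ γ ∈ U, f' γ (Z₂ γ) = c • f' γ (Z₁ γ)) → ∀ᶠ ζ in nhds γ,
        mvfderiv 𝓘(ℝ, EG) Φ ζ (Z₂ ζ) = J (mvfderiv 𝓘(ℝ, EG) Φ ζ (Z₁ ζ)) := fun hZ => by
    filter_upwards [hU.mem_nhds hγ, hnhds] with ζ hζ hζ'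
    obtain ⟨A, hA⟩ := hΦ' ζ hζ'
    refine (hA _).trans (Eq.trans ?_ (congrArg J (hA _)).symm)
    rw [hZ ζ hζ, map_smul]
    rfl
  have h := mvfderiv_complex_mlieBracket hΦ hJ (hsm hX₁) (hsm hX₂) (hsm hY₁) (hsm hY₂) (hZ hX)
    (hZ hY)
  obtain ⟨A, hA⟩ := hΦ' γ (ChartedSpace.mem_chart_source _)
  have h1 := (hA _).symm.trans (h.trans (congrArg J (hA _)))
  change _ = c • A _ at h1
  rw [← map_smul] at h1
  exact A.injective h1

end Involutive

section Groupoid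

variable {E : Type*} [NormedAddCommGroup E] [NormedSpace ℂ E]
  {M : Type*} [TopologicalSpace M] [ChartedSpace E M]
  {EG : Type*} [NormedAddCommGroup EG] [NormedSpace ℝ EG]
  {G : Type*} [TopologicalSpace G] [ChartedSpace EG G]

namespace LieGroupoid

/-- The preimage under `T(t, s)` of the antiholomorphic and the holomorphic tangent bundle, as a
subspace of the complexified model space. -/
noncomputable def polarizationAt (𝒢 : LieGroupoid EG G E M) (γ : G) : Submodule ℂ (ℂ ⊗[ℝ] EG) :=
  polarizationSubspace (𝒢.dTgt γ).toLinearMap (𝒢.dSrc γ).toLinearMap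

theorem anchorPreimage_antiholomorphic (𝒢 : LieGroupoid EG G E M) :
    𝒢.anchorPreimage (antiholomorphicTangentBundle E M)
      (fun x => conjSubmodule (antiholomorphicTangentBundle E M x)) = 𝒢.polarizationAt :=
  rfl

variable {𝒢 : LieGroupoid EG G E M}

theorem complexVector_mem_polarizationAt {γ : G} {X Y : EG} :
    complexVector X Y ∈ 𝒢.polarizationAt γ ↔
      𝒢.dTgt γ Y = Complex.I • 𝒢.dTgt γ X ∧ 𝒢.dSrc γ Y = -(Complex.I • 𝒢.dSrc γ X) :=
  complexVector_mem_polarizationSubspace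

theorem isInvolutive_polarizationAt [CompleteSpace EG] [IsManifold 𝓘(ℝ, EG) ∞ G]
    [IsManifold 𝓘(ℂ, E) ω M] :
    IsInvolutive (E := EG) (M := G) 𝒢.polarizationAt := by
  intro U hU X₁ X₂ Y₁ Y₂ hX₁ hX₂ hY₁ hY₂ hX hY γ hγ
  have h1 := fun ζ hζ => complexVector_mem_polarizationAt.1 (hX ζ hζ)
  have h2 := fun ζ hζ => complexVector_mem_polarizationAt.1 (hY ζ hζ)
  simp only [← neg_smul] at h1 h2
  refine complexVector_mem_polarizationAt.2 ⟨?_, ?_⟩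
  · exact smul_apply_complex_mlieBracket 𝒢.smooth_tgt 𝒢.hasModelDerivAt_tgt Complex.I_mul_I hU
      hX₁ hX₂ hY₁ hY₂ (fun ζ hζ => (h1 ζ hζ).1) (fun ζ hζ => (h2 ζ hζ).1) hγ
  · rw [← neg_smul]
    exact smul_apply_complex_mlieBracket 𝒢.smooth_src 𝒢.hasModelDerivAt_src
      (by rw [neg_mul_neg, Complex.I_mul_I]) hU
      hX₁ hX₂ hY₁ hY₂ (fun ζ hζ => (h1 ζ hζ).2) (fun ζ hζ => (h2 ζ hζ).2) hγ

theorem isHermitian_polarizationAt : 𝒢.IsHermitian 𝒢.polarizationAt := by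
  intro γ
  have h1 : ∀ Z, 𝒢.dSrc γ (𝒢.dInv (𝒢.inv γ) Z) = 𝒢.dTgt (𝒢.inv γ) Z := fun Z => by
    rw [← 𝒢.dTgt_dInv, 𝒢.dInv_dInv']
  have h2 : ∀ Z, 𝒢.dTgt γ (𝒢.dInv (𝒢.inv γ) Z) = 𝒢.dSrc (𝒢.inv γ) Z := fun Z => by
    rw [← 𝒢.dSrc_dInv, 𝒢.dInv_dInv']
  change (𝒢.polarizationAt γ).map (LinearMap.baseChange ℂ (𝒢.dInv γ).toLinearMap) =
    conjSubmodule (𝒢.polarizationAt (𝒢.inv γ))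
  ext Z
  obtain ⟨Z₁, Z₂, rfl⟩ := exists_complexVector Z
  rw [complexVector_mem_conjSubmodule, complexVector_mem_polarizationAt, Submodule.mem_map]
  constructor
  · rintro ⟨X, hX, hXZ⟩
    obtain ⟨X₁, X₂, rfl⟩ := exists_complexVector X
    rw [baseChange_complexVector, complexVector_inj] at hXZ
    obtain ⟨rfl, rfl⟩ := hXZ
    rw [complexVector_mem_polarizationAt] at hX
    simp [dTgt_dInv, dSrc_dInv, hX]
  · rintro ⟨h3, h4⟩
    rw [map_neg, neg_eq_iff_eq_neg] at h3
    rw [map_neg, neg_inj] at h4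
    refine ⟨complexVector (𝒢.dInv (𝒢.inv γ) Z₁) (𝒢.dInv (𝒢.inv γ) Z₂), ?_, ?_⟩
    · rw [complexVector_mem_polarizationAt, h1, h1, h2, h2]
      exact ⟨h4, h3⟩
    · simp [dInv_dInv']

theorem dMul_apply (γ η : G) (X Y : EG) :
    𝒢.dMul γ η (X, Y) = 𝒢.dMul γ η (X, 0) + 𝒢.dMul γ η (0, Y) := by
  rw [← map_add, Prod.mk_add_mk, add_zero, zero_add]

theorem complexTangentMul_complexVector (γ η : G) (X X' Y Y' : EG) :
    𝒢.complexTangentMul γ η (complexVector X X') (complexVector Y Y') =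
      complexVector (𝒢.dMul γ η (X, Y)) (𝒢.dMul γ η (X', Y')) := by
  rw [dMul_apply γ η X Y, dMul_apply γ η X' Y', ← complexVector_add]
  exact congrArg₂ (· + ·)
    (baseChange_complexVector ((𝒢.dMul γ η).toLinearMap ∘ₗ LinearMap.inl ℝ EG EG) X X')
    (baseChange_complexVector ((𝒢.dMul γ η).toLinearMap ∘ₗ LinearMap.inr ℝ EG EG) Y Y')

theorem complexComposable_iff {γ η : G} (h : 𝒢.src γ = 𝒢.tgt η) {X X' Y Y' : EG} :
    𝒢.ComplexComposable (γ := γ) (η := η) (complexVector X X') (complexVector Y Y') ↔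
      𝒢.dSrc γ X = 𝒢.dTgt η Y ∧ 𝒢.dSrc γ X' = 𝒢.dTgt η Y' := by
  have h1 : ∀ (x y : M) (v w : ℂ ⊗[ℝ] E), x = y →
      ((⟨x, v⟩ : Σ x : M, ComplexTangentSpace E x) = ⟨y, w⟩ ↔ v = w) := by
    rintro x _ v w rfl
    refine ⟨fun h => ?_, fun h => by rw [h]⟩
    exact eq_of_heq (Sigma.mk.inj h).2
  refine (h1 _ _ _ _ h).trans (Iff.trans ?_ complexVector_inj)
  exact iff_of_eq (congrArg₂ (· = ·) (baseChange_complexVector (𝒢.dSrc γ).toLinearMap X X')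
    (baseChange_complexVector (𝒢.dTgt η).toLinearMap Y Y'))

/-- If the polarization is spanned by its parts tangent to the fibres of the source and of the
target, then it is multiplicative, because these parts are preserved by right and left
translations, respectively. Conversely, vectors `X` and `Y` of the polarization are composable
only if `T s (X)` and `T t (Y)` vanish, being both holomorphic and antiholomorphic. -/
theorem isMultiplicative_polarizationAt [FiniteDimensional ℂ E] [IsManifold 𝓘(ℝ, EG) ∞ G]
    [IsManifold 𝓘(ℂ, E) ω M]
    (hspan : ∀ γ, 𝒢.polarizationAt γ ≤
      (𝒢.polarizationAt γ ⊓ LinearMap.ker (LinearMap.baseChange ℂ (𝒢.dSrc γ).toLinearMap)) ⊔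
        (𝒢.polarizationAt γ ⊓ LinearMap.ker (LinearMap.baseChange ℂ (𝒢.dTgt γ).toLinearMap))) :
    𝒢.IsMultiplicative 𝒢.polarizationAt := by
  intro γ η h
  apply Set.Subset.antisymm
  · rintro _ ⟨X, hX, Y, hY, hXY, rfl⟩
    -- The tangent spaces at `γ` and `η` are replaced by the model space.
    obtain ⟨X₁, X₂, rfl⟩ := exists_complexVector (V := EG) X
    obtain ⟨Y₁, Y₂, rfl⟩ := exists_complexVector (V := EG) Y
    have hmem : ∀ Z Z' : ℂ ⊗[ℝ] EG, Z = Z' → Z' ∈ 𝒢.polarizationAt (𝒢.mul γ η) →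
        Z ∈ 𝒢.polarizationAt (𝒢.mul γ η) := fun Z Z' h h' => h ▸ h'
    refine hmem _ _ (complexTangentMul_complexVector γ η X₁ X₂ Y₁ Y₂) ?_
    obtain ⟨h1, h2⟩ := (complexComposable_iff h).1 hXY
    obtain ⟨h3, h4⟩ := complexVector_mem_polarizationAt.1 hX
    obtain ⟨h5, h6⟩ := complexVector_mem_polarizationAt.1 hY
    -- The common image in the tangent space of the base is both holomorphic and antiholomorphic.
    have h7 : 𝒢.dSrc γ X₁ = 0 := by
      rw [← h2, ← h1, h4, neg_eq_iff_add_eq_zero, ← two_smul ℂ, smul_smul] at h5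
      exact (smul_eq_zero_iff_right (by simp)).1 h5
    have h8 : 𝒢.dSrc γ X₂ = 0 := by rw [h4, h7, smul_zero, neg_zero]
    rw [h7] at h1
    rw [h8] at h2
    obtain ⟨a1, a2⟩ := dTgt_dMul_zero_right h h7
    obtain ⟨a3, a4⟩ := dTgt_dMul_zero_right h h8
    obtain ⟨b1, b2⟩ := dSrc_dMul_zero_left h h1.symm
    obtain ⟨b3, b4⟩ := dSrc_dMul_zero_left h h2.symm
    refine complexVector_mem_polarizationAt.2 ?_
    rw [dMul_apply γ η X₁, dMul_apply γ η X₂]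
    simp only [map_add, a1, a2, a3, a4, b1, b2, b3, b4, add_zero, zero_add]
    exact ⟨h3, h6⟩
  · intro Z hZ
    obtain ⟨A, ⟨hA, hA'⟩, B, ⟨hB, hB'⟩, rfl⟩ := Submodule.mem_sup.1 (hspan _ hZ)
    obtain ⟨A₁, A₂, rfl⟩ := exists_complexVector A
    obtain ⟨B₁, B₂, rfl⟩ := exists_complexVector B
    rw [SetLike.mem_coe, LinearMap.mem_ker, baseChange_complexVector,
      complexVector_eq_zero] at hA' hB'
    obtain ⟨X₁, a1, a2, a3⟩ := exists_dMul_zero_right h hA'.1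
    obtain ⟨X₂, a4, a5, a6⟩ := exists_dMul_zero_right h hA'.2
    obtain ⟨Y₁, b1, b2, b3⟩ := exists_dMul_zero_left h hB'.1
    obtain ⟨Y₂, b4, b5, b6⟩ := exists_dMul_zero_left h hB'.2
    have hA1 := complexVector_mem_polarizationAt.1 hA
    have hB1 := complexVector_mem_polarizationAt.1 hB
    refine ⟨complexVector X₁ X₂, complexVector_mem_polarizationAt.2 ?_, complexVector Y₁ Y₂,
      complexVector_mem_polarizationAt.2 ?_, (complexComposable_iff h).2 ?_, ?_⟩
    · rw [a1, a4, a2, a5]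
      exact ⟨hA1.1, by simp⟩
    · rw [b1, b4, b2, b5]
      exact ⟨by simp, hB1.2⟩
    · rw [a1, a4, b1, b4]
      exact ⟨rfl, rfl⟩
    · rw [complexTangentMul_complexVector, dMul_apply γ η X₁, dMul_apply γ η X₂,
        a3, a6, b3, b6, complexVector_add]

end LieGroupoid

section Rank

theorem IsRegularDistribution.isLocallyConstant_finrank [IsManifold 𝓘(ℝ, EG) ∞ G]
    {P : G → Submodule ℂ (ℂ ⊗[ℝ] EG)} (hP : IsRegularDistribution (E := EG) (M := G) P) :
    IsLocallyConstant fun γ => Module.finrank ℂ (P γ) := by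
  rw [IsLocallyConstant.iff_exists_open]
  intro γ
  obtain ⟨U, hU, hγ, r, X, Y, -, -, h⟩ := hP γ
  have h1 : ∀ ζ ∈ U, Module.finrank ℂ (P ζ) = r := fun ζ hζ => by
    have h2 := finrank_span_eq_card (h ζ hζ).1
    rw [(h ζ hζ).2, Fintype.card_fin] at h2
    exact h2
  exact ⟨U, hU, hγ, fun ζ hζ => by rw [h1 ζ hζ, h1 γ hγ]⟩

end Rank

namespace SymplecticGroupoid

variable [FiniteDimensional ℂ E] [IsManifold 𝓘(ℂ, E) ω M] [FiniteDimensional ℝ EG]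
  [IsManifold 𝓘(ℝ, EG) ∞ G] {π : PoissonStructure E M} {S : SymplecticGroupoid EG G E M}

/-- The rank of a regular polarization is computed at a unit, and it is constant along the
connected source fibre through that unit. -/
theorem finrank_polarizationAt (hS : S.Integrates π)
    (hP : IsRegularDistribution (E := EG) (M := G) S.polarizationAt) (γ : G) :
    Module.finrank ℝ EG = 2 * Module.finrank ℂ (S.polarizationAt γ) := by
  have h1 := hP.isLocallyConstant_finrank.apply_eq_of_isPreconnected
    (hS.src_connected (S.src γ)).isPreconnected (x := γ) (y := S.unit (S.src γ)) rfl
    (S.src_unit _)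
  have h2 := finrank_polarizationSubspace_of_section
    (t := (S.dTgt (S.unit (S.src γ))).toLinearMap) (s := (S.dSrc (S.unit (S.src γ))).toLinearMap)
    (u := (S.dUnit (S.src γ)).toLinearMap) (S.dTgt_dUnit _) (S.dSrc_dUnit _)
  have h3 := S.finrank_eq_two_mul_finrank (S.src γ)
  change Module.finrank ℂ (S.polarizationAt γ) =
    Module.finrank ℂ (S.polarizationAt (S.unit (S.src γ))) at h1
  change Module.finrank ℂ (S.polarizationAt (S.unit (S.src γ))) + _ = _ at h2
  omega

theorem orthogonal_polarizationAt_le (hπ : π.IsKaehlerPoisson) (hS : S.Integrates π) (γ : G) :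
    (LinearMap.BilinForm.baseChange ℂ (S.formAt γ)).orthogonal (S.polarizationAt γ) ≤
      (S.polarizationAt γ ⊓ LinearMap.ker (LinearMap.baseChange ℂ (S.dSrc γ).toLinearMap)) ⊔
        (S.polarizationAt γ ⊓ LinearMap.ker (LinearMap.baseChange ℂ (S.dTgt γ).toLinearMap)) :=
  orthogonal_polarizationSubspace_le (S.isAlt_formAt γ) (S.formAt_nondegenerate γ)
    (S.submersion_tgt γ) (S.submersion_src γ) (fun _ => S.dSrc_eq_zero) (fun _ => S.dTgt_eq_zero)
    (pullbackInvolution_dTgt hπ hS γ) (pullbackInvolution_dSrc hπ hS γ)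

theorem orthogonal_polarizationAt_eq (hπ : π.IsKaehlerPoisson) (hS : S.Integrates π)
    (hP : IsRegularDistribution (E := EG) (M := G) S.polarizationAt) (γ : G) :
    (LinearMap.BilinForm.baseChange ℂ (S.formAt γ)).orthogonal (S.polarizationAt γ) =
      S.polarizationAt γ :=
  orthogonal_polarizationSubspace_eq (S.isAlt_formAt γ) (S.formAt_nondegenerate γ)
    (S.submersion_tgt γ) (S.submersion_src γ) (fun _ => S.dSrc_eq_zero) (fun _ => S.dTgt_eq_zero)
    (pullbackInvolution_dTgt hπ hS γ) (pullbackInvolution_dSrc hπ hS γ)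
    (finrank_polarizationAt hS hP γ)

theorem isLagrangian_polarizationAt (hπ : π.IsKaehlerPoisson) (hS : S.Integrates π)
    (hP : IsRegularDistribution (E := EG) (M := G) S.polarizationAt) :
    IsLagrangian (E := EG) (M := G) S.form S.polarizationAt := by
  intro γ X
  have hrefl := (isAlt_baseChange (S.isAlt_formAt γ)).isRefl
  have h : X ∈ S.polarizationAt γ ↔
      ∀ Y ∈ S.polarizationAt γ, LinearMap.BilinForm.baseChange ℂ (S.formAt γ) X Y = 0 := by
    conv_lhs => rw [← orthogonal_polarizationAt_eq hπ hS hP γ]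
    exact forall₂_congr fun Y _ => hrefl.eq_iff
  exact h

end SymplecticGroupoid

end Groupoid

theorem mainTheorem5
    {E : Type*} [NormedAddCommGroup E] [NormedSpace ℂ E] [FiniteDimensional ℂ E]
    {M : Type*} [TopologicalSpace M] [ChartedSpace E M] [IsManifold 𝓘(ℂ, E) ω M]
    (π : PoissonStructure E M) (hπ : π.IsKaehlerPoisson)
    {EG : Type*} [NormedAddCommGroup EG] [NormedSpace ℝ EG] [FiniteDimensional ℝ EG]
    {G : Type*} [TopologicalSpace G] [ChartedSpace EG G] [IsManifold 𝓘(ℝ, EG) ∞ G]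
    (S : SymplecticGroupoid EG G E M) (hS : S.Integrates π)
    (hP : IsRegularDistribution
      (S.anchorPreimage (antiholomorphicTangentBundle E M)
        (fun x => conjSubmodule (antiholomorphicTangentBundle E M x)))) :
    S.IsPolarization
      (S.anchorPreimage (antiholomorphicTangentBundle E M)
        (fun x => conjSubmodule (antiholomorphicTangentBundle E M x))) := by
  have : CompleteSpace EG := FiniteDimensional.complete ℝ EG
  rw [LieGroupoid.anchorPreimage_antiholomorphic] at hP ⊢
  exact
    { regular := hP
      involutive := LieGroupoid.isInvolutive_polarizationAt
      multiplicative := LieGroupoid.isMultiplicative_polarizationAt fun γ =>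
        (SymplecticGroupoid.orthogonal_polarizationAt_eq hπ hS hP γ).ge.trans
          (SymplecticGroupoid.orthogonal_polarizationAt_le hπ hS γ)
      hermitian := LieGroupoid.isHermitian_polarizationAt
      lagrangian := SymplecticGroupoid.isLagrangian_polarizationAt hπ hS hP }
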